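/- For $d,\rho,\delta\in\mathbb R$ let $S^d_{\rho,\delta}(\mathbb R^n\times\mathbb R^n)$ be the set of $a\in C^\infty(\mathbb R^{2n})$ with $|D_\xi^\alpha D_x^\beta a(x,\xi)|\le C_{\alpha\beta}(1+|\xi|)^{d-\rho|\alpha|+\delta|\beta|}$ for all multi-indices $\alpha,\beta$, and let $S^\infty_{1,1}=\bigcup_{d\in\mathbb R}S^d_{1,1}$. For a symbol $a$ and $v\in\mathcal S(\mathbb R^n)$ put $$\operatorname{OP}(a)v(x)=(2\pi)^{-n}\int e^{i x\cdot\xi}a(x,\xi)\hat v(\xi)\,d\xi,\qquad \hat v(\xi)=\int e^{-i x\cdot\xi}v(x)\,dx .$$ Let $\mathcal F^{-1}\mathcal E'(\mathbb R^n)$ be the space of $u\in\mathcal S'(\mathbb R^n)$ with compact spectrum, i.e. for which $\operatorname{supp}\hat u$ is compact, and let $O_M(\mathbb R^n)$ be the space of $f\in C^\infty(\mathbb R^n)$ such that for every $\alpha\in\mathbb N_0^n$ there are $c_\alpha,N_\alpha$ with $|D^\alpha f(x)|\le c_\alpha(1+|x|)^{N_\alpha}$ for all $x$. Proposition. Let $a\in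 S^\infty_{1,1}(\mathbb R^n\times\mathbb R^n)$. Then $a(x,D)$ is well defined as a linear map $A\colon\mathcal F^{-1}\mathcal E'(\mathbb R^n)\to\mathcal S'(\mathbb R^n)$, in the following sense. There is one and only one map $A$ on $\mathcal F^{-1}\mathcal E'(\mathbb R^n)$ such that, for every $u\in\mathcal F^{-1}\mathcal E'(\mathbb R^n)$ and every $\chi\in C_0^\infty(\mathbb R^n)$ equal to $1$ in a neighbourhood of $\operatorname{supp}\hat u$, the operator with symbol $b(x,\xi)=a(x,\xi)\chi(\xi)$ maps $\mathcal S(\mathbb R^n)$ to itself, has exactly one continuous linear extension $b(x,D)\colon\mathcal S'(\mathbb R^n)\to\mathcal S'(\mathbb R^n)$, and satisfies $Au=b(x,D)u$ (so the value does not depend on $\chi$); and this $A$ is linear. Moreover, $Au=\operatorname{OP}(a)u\in\mathcal S(\mathbb R^n)$ for $u\in\mathcal S(\mathbb R^n)\cap\mathcal F^{-1}\mathcal E'(\mathbb R^n)$; and if $\operatorname{OP}(a)$ maps $\mathcal S(\mathbb R^n)$ to itself and has a continuous linear extension $T\colon\mathcal S'(\mathbb R^n)\to\mathcal S'(\mathbb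 R^n)$ (as is the case for $a\in\bigcup_d S^d_{1,0}$), then $A$ is the restriction of $T$. Finally, the range of $A$ is contained in $O_M(\mathbb R^n)$. -/

import Mathlib

open scoped SchwartzMap FourierTransform ContDiff Topology Pointwise

noncomputable section

namespace TypeOneOne

/-- Euclidean space `ℝⁿ`. -/
abbrev Rn (n : ℕ) : Type := EuclideanSpace ℝ (Fin n)

/-- Hörmander's class `S^d_{ρ,δ}(ℝⁿ × ℝⁿ)`: smooth `a(x, ξ)` such that every derivative of order
`k` in `ξ` and order `l` in `x` is bounded by a constant times `(1 + |ξ|)^(d - ρ k + δ l)`. -/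
def IsSymbol {n : ℕ} (d ρ δ : ℝ) (a : Rn n → Rn n → ℂ) : Prop :=
  ContDiff ℝ ∞ (fun p : Rn n × Rn n => a p.1 p.2) ∧
    ∀ k l : ℕ, ∃ C : ℝ, ∀ x ξ : Rn n,
      ‖iteratedFDeriv ℝ k (fun η => iteratedFDeriv ℝ l (fun y => a y η) x) ξ‖
        ≤ C * (1 + ‖ξ‖) ^ (d - ρ * k + δ * l)

/-- The class `S^∞_{1,1} = ⋃_d S^d_{1,1}`. -/
def IsSymbolOneOne {n : ℕ} (a : Rn n → Rn n → ℂ) : Prop :=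
  ∃ d : ℝ, IsSymbol d 1 1 a

/-- The Fourier transform `v̂(ξ) = ∫ e^{-i x·ξ} v(x) dx` of a Schwartz function, written through
Mathlib's `𝓕 v (η) = ∫ e^{-2πi x·η} v(x) dx`. -/
def hat {n : ℕ} (v : 𝓢(Rn n, ℂ)) (ξ : Rn n) : ℂ :=
  𝓕 v ((2 * Real.pi)⁻¹ • ξ)

/-- `OP(a) v (x) = (2π)⁻ⁿ ∫ e^{i x·ξ} a(x, ξ) v̂(ξ) dξ` for a Schwartz function `v`. -/
def op {n : ℕ} (a : Rn n → Rn n → ℂ) (v : 𝓢(Rn n, ℂ)) (x : Rn n) : ℂ :=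
  (((2 * Real.pi) ^ n)⁻¹ : ℝ) *
    ∫ ξ : Rn n, Complex.exp (Complex.I * (inner ℝ x ξ : ℝ)) * a x ξ * hat v ξ

/-- The tempered distribution given by a Schwartz function. -/
abbrev toDistr {n : ℕ} (v : 𝓢(Rn n, ℂ)) : 𝓢'(Rn n, ℂ) :=
  SchwartzMap.toTemperedDistributionCLM (Rn n) ℂ MeasureTheory.volume v

/-- `OP(a)` maps Schwartz functions to Schwartz functions, and `T : 𝓢' → 𝓢'` is a continuous
linear extension of it. -/
def IsContinuousExtension {n : ℕ} (a : Rn n → Rn n → ℂ)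
    (T : 𝓢'(Rn n, ℂ) →L[ℂ] 𝓢'(Rn n, ℂ)) : Prop :=
  ∀ v : 𝓢(Rn n, ℂ), ∃ w : 𝓢(Rn n, ℂ), (∀ x, w x = op a v x) ∧ T (toDistr v) = toDistr w

/-- The spectrum of a tempered distribution: the support of its Fourier transform. The dilation
by `2π` passes from Mathlib's frequency variable to the one used in `hat`. -/
def spec {n : ℕ} (u : 𝓢'(Rn n, ℂ)) : Set (Rn n) :=
  (2 * Real.pi) • Distribution.dsupport (𝓕 u : 𝓢'(Rn n, ℂ))

theorem dsupport_add_subset {n : ℕ} (f g : 𝓢'(Rn n, ℂ)) :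
    Distribution.dsupport (f + g : 𝓢'(Rn n, ℂ)) ⊆
      Distribution.dsupport f ∪ Distribution.dsupport g := by
  intro x hx
  by_contra h
  simp only [Set.mem_union, not_or, Distribution.notMem_dsupport_iff] at h
  obtain ⟨⟨s, hs, so, xs⟩, t, ht, ht_open, xt⟩ := h
  revert hx
  rw [imp_false, Distribution.notMem_dsupport_iff]
  refine ⟨s ∩ t, fun v hv => ?_, so.inter ht_open, xs, xt⟩
  have h1 := hs v (hv.trans Set.inter_subset_left)
  have h2 := ht v (hv.trans Set.inter_subset_right)
  change f v + g v = 0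
  rw [h1, h2, add_zero]

theorem dsupport_smul_subset {n : ℕ} (c : ℂ) (f : 𝓢'(Rn n, ℂ)) :
    Distribution.dsupport (c • f : 𝓢'(Rn n, ℂ)) ⊆ Distribution.dsupport f := by
  refine Distribution.dsupport_subset_dsupport fun s _ hs v hv => ?_
  change c • f v = 0
  rw [hs v hv, smul_zero]

theorem dsupport_zero {n : ℕ} :
    Distribution.dsupport (0 : 𝓢'(Rn n, ℂ)) = ∅ := by
  refine Set.eq_empty_of_forall_notMem fun x => ?_
  rw [Distribution.notMem_dsupport_iff]
  exact ⟨Set.univ, fun v _ => rfl, isOpen_univ, Set.mem_univ x⟩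

theorem isClosed_spec {n : ℕ} (u : 𝓢'(Rn n, ℂ)) : IsClosed (spec u) :=
  IsClosed.smul_of_ne_zero Distribution.isClosed_dsupport
    (mul_ne_zero two_ne_zero Real.pi_ne_zero)

theorem spec_zero {n : ℕ} : spec (0 : 𝓢'(Rn n, ℂ)) = ∅ := by
  have h : 𝓕 (0 : 𝓢'(Rn n, ℂ)) = 0 := map_zero (FourierTransform.fourierCLM ℂ 𝓢'(Rn n, ℂ))
  unfold spec
  rw [h, dsupport_zero, Set.smul_set_empty]

theorem spec_add_subset {n : ℕ} (u v : 𝓢'(Rn n, ℂ)) : spec (u + v) ⊆ spec u ∪ spec v := by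
  have h : 𝓕 (u + v) = 𝓕 u + 𝓕 v := FourierTransform.fourier_add u v
  unfold spec
  rw [h, ← Set.smul_set_union]
  exact Set.smul_set_mono (dsupport_add_subset _ _)

theorem spec_smul_subset {n : ℕ} (c : ℂ) (u : 𝓢'(Rn n, ℂ)) : spec (c • u) ⊆ spec u := by
  have h : 𝓕 (c • u) = c • 𝓕 u := FourierTransform.fourier_smul c u
  unfold spec
  rw [h]
  exact Set.smul_set_mono (dsupport_smul_subset _ _)

/-- `𝓕⁻¹𝓔'(ℝⁿ)`: the tempered distributions with compact spectrum. -/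
def compactSpectrum (n : ℕ) : Submodule ℂ 𝓢'(Rn n, ℂ) where
  carrier := {u | IsCompact (spec u)}
  zero_mem' := by
    change IsCompact (spec (0 : 𝓢'(Rn n, ℂ)))
    rw [spec_zero]
    exact isCompact_empty
  add_mem' := fun {u v} (hu : IsCompact (spec u)) (hv : IsCompact (spec v)) =>
    (hu.union hv).of_isClosed_subset (isClosed_spec _) (spec_add_subset u v)
  smul_mem' := fun c {u} (hu : IsCompact (spec u)) =>
    hu.of_isClosed_subset (isClosed_spec _) (spec_smul_subset c u)

/-- `χ ∈ C₀^∞(ℝⁿ)` is equal to `1` in a neighbourhood of the spectrum of `u`. -/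
def IsSpectralCutoff {n : ℕ} (χ : Rn n → ℂ) (u : 𝓢'(Rn n, ℂ)) : Prop :=
  ContDiff ℝ ∞ χ ∧ HasCompactSupport χ ∧ ∀ᶠ ξ in 𝓝ˢ (spec u), χ ξ = 1

/-- The symbol `a(x, ξ) χ(ξ)`. -/
def cutSymbol {n : ℕ} (a : Rn n → Rn n → ℂ) (χ : Rn n → ℂ) : Rn n → Rn n → ℂ :=
  fun x ξ => a x ξ * χ ξ

/-- `A` is the operator `a(x, D)` on the distributions with compact spectrum: for each such `u` and
*every* cut-off `χ` equal to `1` near the spectrum of `u`, the operator with the truncated symbol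
`a(x, ξ) χ(ξ)` has exactly one continuous extension to `𝓢'`, and its value at `u` is `A u`. -/
def IsOperatorOnCompactSpectrum {n : ℕ} (a : Rn n → Rn n → ℂ)
    (A : compactSpectrum n → 𝓢'(Rn n, ℂ)) : Prop :=
  ∀ (u : compactSpectrum n) (χ : Rn n → ℂ), IsSpectralCutoff χ (u : 𝓢'(Rn n, ℂ)) →
    ∃ T : 𝓢'(Rn n, ℂ) →L[ℂ] 𝓢'(Rn n, ℂ), IsContinuousExtension (cutSymbol a χ) T ∧
      (∀ T' : 𝓢'(Rn n, ℂ) →L[ℂ] 𝓢'(Rn n, ℂ),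
        IsContinuousExtension (cutSymbol a χ) T' → T' = T) ∧
      A u = T u

/-- The tempered distribution `f` is a function in `O_M(ℝⁿ)`, i.e. a smooth function all of whose
derivatives are polynomially bounded. -/
def InOM {n : ℕ} (f : 𝓢'(Rn n, ℂ)) : Prop :=
  ∃ (g : Rn n → ℂ) (hg : g.HasTemperateGrowth), f = hg.toTemperedDistribution MeasureTheory.volume

end TypeOneOne

end

/-! A cut-off turns the amplitude into F(x, η) = e^{2πi x·η} a(x, 2πη) χ(2πη), of temperate growth
jointly in (x, η) and zero for large |η|. The type of the symbol enters only through polynomial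
bounds in ξ on all derivatives (`IsSymbol.slowGrowth`).

The operator is extended by duality: ⟨Tu, φ⟩ = ⟨𝓕u, Pφ⟩ with Pφ(η) = ∫ F(x, η) φ(x) dx. The map P is
continuous on Schwartz functions, because φ absorbs the growth in x and Pφ lives in a fixed ball.
Fubini shows that T extends the operator on Schwartz functions (`extOp_toDistr`). The latter
preserves 𝓢: its value at x is the inverse Fourier transform, taken at x, of a Schwartz function of
η whose seminorms are bounded uniformly in x (`exists_pow_mul_oscInt_le`). The extension is unique
because a continuous functional on 𝓢' is evaluation at a test function (`clm_eq_of_toDistr_eq`).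

Two cut-offs give test functions Pφ that agree near the support of 𝓕u, and a distribution does not
distinguish these (`apply_eq_of_eqOn_nhdsSet_dsupport`). Hence Au is independent of χ, and linearity
follows by using one cut-off for several distributions. Compatibility with OP(a) rests on b(x, D) =
a(x, D)χ(D) and χ(D)u = u.

Finally Tu is the function x ↦ ⟨𝓕u, F(x, ·)⟩. By Hahn–Banach, 𝓕u is a finite sum of bounded
functionals applied to weighted derivatives (`exists_eq_sum_jet`). These depend smoothly on x in sup
norm, with polynomial bounds (`hasTemperateGrowth_sliceBCF`), which gives O_M. -/

noncomputable section

namespace TypeOneOne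

/-! ### From mixed symbol estimates to estimates of all joint derivatives. -/

section JointGrowth

variable {X Y V W : Type} [NormedAddCommGroup X] [NormedSpace ℝ X]
  [NormedAddCommGroup Y] [NormedSpace ℝ Y] [NormedAddCommGroup V] [NormedSpace ℝ V]
  [NormedAddCommGroup W] [NormedSpace ℝ W]

theorem iteratedFDeriv_slice_snd {f : X × Y → V} (hf : ContDiff ℝ ∞ f) (l : ℕ) (x : X) (η : Y) :
    iteratedFDeriv ℝ l (fun y => f (x, y)) η =
      (iteratedFDeriv ℝ l f (x, η)).compContinuousLinearMap
        (fun _ => ContinuousLinearMap.inr ℝ X Y) := by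
  have h1 : (fun y => f (x, y)) =
      (fun z => f ((x, 0) + z)) ∘ (ContinuousLinearMap.inr ℝ X Y) := by
    ext y; simp
  have h2 : ContDiff ℝ ∞ (fun z => f ((x, 0) + z)) := by fun_prop
  rw [h1, ContinuousLinearMap.iteratedFDeriv_comp_right _ h2 η (mod_cast le_top),
    iteratedFDeriv_comp_add_left]
  simp

/-- The partial derivative in the first variable. -/
def dFst (f : X × Y → V) (p : X × Y) : X →L[ℝ] V :=
  (fderiv ℝ f p).comp (ContinuousLinearMap.inl ℝ X Y)

/-- The partial derivative in the second variable. -/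
def dSnd (f : X × Y → V) (p : X × Y) : Y →L[ℝ] V :=
  (fderiv ℝ f p).comp (ContinuousLinearMap.inr ℝ X Y)

theorem contDiff_dFst {f : X × Y → V} (hf : ContDiff ℝ ∞ f) : ContDiff ℝ ∞ (dFst f) :=
  (hf.fderiv_right (m := ∞) le_rfl).clm_comp contDiff_const

theorem contDiff_dSnd {f : X × Y → V} (hf : ContDiff ℝ ∞ f) : ContDiff ℝ ∞ (dSnd f) :=
  (hf.fderiv_right (m := ∞) le_rfl).clm_comp contDiff_const

theorem hasFDerivAt_slice_fst {f : X × Y → V} (hf : ContDiff ℝ ∞ f) (x : X) (η : Y) :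
    HasFDerivAt (fun y => f (y, η)) (dFst f (x, η)) x := by
  have h := (hf.differentiable (by simp) (x, η)).hasFDerivAt
  exact h.comp x (hasFDerivAt_prodMk_left x η)

theorem hasFDerivAt_slice_snd {f : X × Y → V} (hf : ContDiff ℝ ∞ f) (x : X) (η : Y) :
    HasFDerivAt (fun y => f (x, y)) (dSnd f (x, η)) η := by
  have h := (hf.differentiable (by simp) (x, η)).hasFDerivAt
  exact h.comp η (hasFDerivAt_prodMk_right x η)

/-- All mixed derivatives, first in the first and then in the second variable, are bounded by
powers of `1 + ‖p.2‖`. -/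
def MixedBound (f : X × Y → V) : Prop :=
  ∀ k l : ℕ, ∃ (N : ℕ) (C : ℝ), ∀ x ξ,
    ‖iteratedFDeriv ℝ k (fun η => iteratedFDeriv ℝ l (fun y => f (y, η)) x) ξ‖
      ≤ C * (1 + ‖ξ‖) ^ N

theorem norm_iteratedFDeriv_of_isometry (e : V ≃ₗᵢ[ℝ] W) {g : Y → V} {g' : Y → W}
    (h : ∀ η, g' η = e (g η)) (k : ℕ) (ξ : Y) :
    ‖iteratedFDeriv ℝ k g ξ‖ = ‖iteratedFDeriv ℝ k g' ξ‖ := by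
  have : g' = e ∘ g := funext h
  rw [this, LinearIsometryEquiv.norm_iteratedFDeriv_comp_left]

/-- The l-th x-derivative of `dFst f` is the (l+1)-st one of f up to currying. Currying is a linear
isometry of the values, so it does not change the norms of the η-derivatives. -/
theorem MixedBound.dFst {f : X × Y → V} (hf : ContDiff ℝ ∞ f) (h : MixedBound f) :
    MixedBound (dFst f) := by
  intro k l
  obtain ⟨N, C, hC⟩ := h k (l + 1)
  refine ⟨N, C, fun x ξ => le_of_eq_of_le ?_ (hC x ξ)⟩
  refine norm_iteratedFDeriv_of_isometry
    (continuousMultilinearCurryRightEquiv' ℝ l X V).symm (fun η => ?_) k ξ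
  rw [iteratedFDeriv_succ_eq_comp_right]
  have : fderiv ℝ (fun y => f (y, η)) = fun y => TypeOneOne.dFst f (y, η) := by
    ext1 y; exact (hasFDerivAt_slice_fst hf y η).fderiv
  rw [this]; rfl

/-- All derivatives in the second variable are bounded by powers of `1 + ‖p.2‖`. -/
def SndBound (f : X × Y → V) : Prop :=
  ∀ k : ℕ, ∃ (N : ℕ) (C : ℝ), ∀ x ξ,
    ‖iteratedFDeriv ℝ k (fun η => f (x, η)) ξ‖ ≤ C * (1 + ‖ξ‖) ^ N

/-- `SndBound` for the function and its first `l` derivatives in the first variable. -/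
def IterSndBound (l : ℕ) {V : Type} [NormedAddCommGroup V] [NormedSpace ℝ V]
    (f : X × Y → V) : Prop :=
  match l with
  | 0 => SndBound f
  | l + 1 => SndBound f ∧ IterSndBound l (TypeOneOne.dFst f)

theorem MixedBound.sndBound {f : X × Y → V} (h : MixedBound f) : SndBound f := by
  intro k
  obtain ⟨N, C, hC⟩ := h k 0
  refine ⟨N, C, fun x ξ => le_of_eq_of_le ?_ (hC x ξ)⟩
  exact norm_iteratedFDeriv_of_isometry (continuousMultilinearCurryFin0 ℝ X V).symm
    (fun η => rfl) k ξ

/-- Replaces mixed derivatives by iterated `dFst`, a form that is also stable under `dSnd`. The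
target space is quantified inside because every x-derivative changes it. -/
theorem MixedBound.iterSndBound (l : ℕ) :
    ∀ {V : Type} [NormedAddCommGroup V] [NormedSpace ℝ V] {f : X × Y → V}, ContDiff ℝ ∞ f →
      MixedBound f → IterSndBound l f := by
  induction l with
  | zero => intro V _ _ f hf h; exact h.sndBound
  | succ l ih => intro V _ _ f hf h; exact ⟨h.sndBound, ih (contDiff_dFst hf) (h.dFst hf)⟩

theorem SndBound.clm_comp (L : V →L[ℝ] W) {f : X × Y → V} (hf : ContDiff ℝ ∞ f)
    (h : SndBound f) : SndBound (fun p => L (f p)) := by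
  intro k
  obtain ⟨N, C, hC⟩ := h k
  refine ⟨N, ‖L‖ * C, fun x ξ => ?_⟩
  have hs : ContDiff ℝ ∞ (fun η => f (x, η)) := hf.comp (contDiff_prodMk_right x)
  refine (L.norm_iteratedFDeriv_comp_left hs.contDiffAt (mod_cast le_top)).trans ?_
  rw [mul_assoc]
  gcongr
  exact hC x ξ

theorem dFst_clm_comp (L : V →L[ℝ] W) {f : X × Y → V} (hf : ContDiff ℝ ∞ f) :
    dFst (fun p => L (f p)) = fun p => (ContinuousLinearMap.compL ℝ X V W L) (dFst f p) := by
  ext p h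
  have : fderiv ℝ (fun p => L (f p)) p = L.comp (fderiv ℝ f p) :=
    (L.hasFDerivAt.comp p (hf.differentiable (by simp) p).hasFDerivAt).fderiv
  simp [TypeOneOne.dFst, this]

theorem IterSndBound.clm_comp (l : ℕ) :
    ∀ {V W : Type} [NormedAddCommGroup V] [NormedSpace ℝ V] [NormedAddCommGroup W]
      [NormedSpace ℝ W] (L : V →L[ℝ] W) {f : X × Y → V}, ContDiff ℝ ∞ f →
      IterSndBound l f → IterSndBound l (fun p => L (f p)) := by
  induction l with
  | zero => intro V W _ _ _ _ L f hf h; exact SndBound.clm_comp L hf h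
  | succ l ih =>
    intro V W _ _ _ _ L f hf h
    refine ⟨SndBound.clm_comp L hf h.1, ?_⟩
    rw [dFst_clm_comp L hf]
    exact ih _ (contDiff_dFst hf) h.2

theorem SndBound.dSnd {f : X × Y → V} (hf : ContDiff ℝ ∞ f) (h : SndBound f) :
    SndBound (dSnd f) := by
  intro k
  obtain ⟨N, C, hC⟩ := h (k + 1)
  refine ⟨N, C, fun x ξ => le_of_eq_of_le ?_ (hC x ξ)⟩
  rw [← norm_iteratedFDeriv_fderiv]
  congr 2
  ext1 η
  exact (hasFDerivAt_slice_snd hf x η).fderiv.symm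

/-- Symmetry of the second derivative, with the two arguments exchanged by the flip isometry. -/
theorem dFst_dSnd_comm {f : X × Y → V} (hf : ContDiff ℝ ∞ f) :
    dFst (dSnd f) = fun p => (ContinuousLinearMap.flipₗᵢ ℝ Y X V) (dSnd (dFst f) p) := by
  ext p h h'
  have hd : ContDiff ℝ ∞ (fderiv ℝ f) := hf.fderiv_right (m := ∞) le_rfl
  have hd' := (hd.differentiable (by simp) p).hasFDerivAt
  have e1 : ∀ (q : X × Y) , fderiv ℝ (dSnd f) p q h' = fderiv ℝ (fderiv ℝ f) p q (0, h') := by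
    intro q
    have := (((ContinuousLinearMap.compL ℝ Y (X × Y) V).flip
      (ContinuousLinearMap.inr ℝ X Y)).hasFDerivAt.comp p hd').fderiv
    change fderiv ℝ (((ContinuousLinearMap.compL ℝ Y (X × Y) V).flip
      (ContinuousLinearMap.inr ℝ X Y)) ∘ fderiv ℝ f) p q h' = _
    rw [this]
    simp
  have e2 : ∀ (q : X × Y) , fderiv ℝ (dFst f) p q h = fderiv ℝ (fderiv ℝ f) p q (h, 0) := by
    intro q
    have := (((ContinuousLinearMap.compL ℝ X (X × Y) V).flip
      (ContinuousLinearMap.inl ℝ X Y)).hasFDerivAt.comp p hd').fderiv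
    change fderiv ℝ (((ContinuousLinearMap.compL ℝ X (X × Y) V).flip
      (ContinuousLinearMap.inl ℝ X Y)) ∘ fderiv ℝ f) p q h = _
    rw [this]
    simp
  have hsymm : IsSymmSndFDerivAt ℝ f p :=
    hf.contDiffAt.isSymmSndFDerivAt (by
      rw [minSmoothness_of_isRCLikeNormedField]
      exact (WithTop.coe_le_coe.2 le_top : ((2 : ℕ∞) : ℕ∞ω) ≤ ∞))
  change fderiv ℝ (dSnd f) p (h, 0) h' = fderiv ℝ (dFst f) p (0, h') h
  rw [e1, e2, hsymm]

theorem IterSndBound.dSnd (l : ℕ) :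
    ∀ {V : Type} [NormedAddCommGroup V] [NormedSpace ℝ V] {f : X × Y → V}, ContDiff ℝ ∞ f →
      IterSndBound l f → IterSndBound l (dSnd f) := by
  induction l with
  | zero => intro V _ _ f hf h; exact SndBound.dSnd hf h
  | succ l ih =>
    intro V _ _ f hf h
    refine ⟨SndBound.dSnd hf h.1, ?_⟩
    rw [dFst_dSnd_comm hf]
    exact IterSndBound.clm_comp (W := X →L[ℝ] Y →L[ℝ] V) l
      (ContinuousLinearMap.flipₗᵢ ℝ Y X V).toLinearIsometry.toContinuousLinearMap
      (contDiff_dSnd (contDiff_dFst hf)) (ih (contDiff_dFst hf) h.2)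

theorem IterSndBound.sndBound {l : ℕ} {f : X × Y → V} (h : IterSndBound l f) : SndBound f := by
  cases l with
  | zero => exact h
  | succ l => exact h.1

theorem fderiv_eq_dFst_add_dSnd (f : X × Y → V) :
    fderiv ℝ f =
      ((ContinuousLinearMap.compL ℝ (X × Y) X V).flip (ContinuousLinearMap.fst ℝ X Y)) ∘ dFst f +
      ((ContinuousLinearMap.compL ℝ (X × Y) Y V).flip (ContinuousLinearMap.snd ℝ X Y)) ∘ dSnd f := by
  ext p q
  · simp [dFst, dSnd, show ((0 : X), (0 : Y)) = 0 from rfl]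
  · simp [dFst, dSnd, show ((0 : X), (0 : Y)) = 0 from rfl]

/-- The full derivative is the sum of its two partial parts, and each partial derivative satisfies
the hypothesis again. All levels l are assumed because passing to `dFst` uses up one level. -/
theorem IterSndBound.exists_iteratedFDeriv_le (m : ℕ) :
    ∀ {V : Type} [NormedAddCommGroup V] [NormedSpace ℝ V] {f : X × Y → V}, ContDiff ℝ ∞ f →
      (∀ l, IterSndBound l f) → ∃ (N : ℕ) (C : ℝ), ∀ p, ‖iteratedFDeriv ℝ m f p‖ ≤ C * (1 + ‖p.2‖) ^ N := by
  induction m with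
  | zero =>
    intro V _ _ f hf h
    obtain ⟨N, C, hC⟩ := (h 0).sndBound 0
    refine ⟨N, C, fun p => ?_⟩
    simpa using hC p.1 p.2
  | succ m ih =>
    intro V _ _ f hf h
    obtain ⟨N₁, C₁, h₁⟩ := ih (contDiff_dFst hf) (fun l => (h (l + 1)).2)
    obtain ⟨N₂, C₂, h₂⟩ := ih (contDiff_dSnd hf) (fun l => IterSndBound.dSnd l hf (h l))
    set L₁ := (ContinuousLinearMap.compL ℝ (X × Y) X V).flip (ContinuousLinearMap.fst ℝ X Y)
      with hL₁
    set L₂ := (ContinuousLinearMap.compL ℝ (X × Y) Y V).flip (ContinuousLinearMap.snd ℝ X Y)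
      with hL₂
    -- The base 1 + |p.2| is at least 1, so the sum of the exponents serves both terms.
    refine ⟨N₁ + N₂, ‖L₁‖ * |C₁| + ‖L₂‖ * |C₂|, fun p => ?_⟩
    have c₁ : ContDiff ℝ ∞ (L₁ ∘ TypeOneOne.dFst f) := L₁.contDiff.comp (contDiff_dFst hf)
    have c₂ : ContDiff ℝ ∞ (L₂ ∘ TypeOneOne.dSnd f) := L₂.contDiff.comp (contDiff_dSnd hf)
    rw [← norm_iteratedFDeriv_fderiv, fderiv_eq_dFst_add_dSnd,
      iteratedFDeriv_add_apply (c₁.contDiffAt.of_le (mod_cast le_top))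
      (c₂.contDiffAt.of_le (mod_cast le_top))]
    refine (norm_add_le _ _).trans ?_
    rw [add_mul]
    have one : 1 ≤ 1 + ‖p.2‖ := by simp
    gcongr ?_ + ?_
    · refine (L₁.norm_iteratedFDeriv_comp_left (contDiff_dFst hf).contDiffAt
        (mod_cast le_top)).trans ?_
      rw [mul_assoc]
      gcongr
      refine (h₁ p).trans ?_
      gcongr
      · exact le_abs_self _
      · omega
    · refine (L₂.norm_iteratedFDeriv_comp_left (contDiff_dSnd hf).contDiffAt
        (mod_cast le_top)).trans ?_
      rw [mul_assoc]
      gcongr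
      refine (h₂ p).trans ?_
      gcongr
      · exact le_abs_self _
      · omega

/-- Smooth functions whose joint derivatives are all bounded by powers of `1 + ‖p.2‖`. -/
def SlowGrowth (f : X × Y → V) : Prop :=
  ContDiff ℝ ∞ f ∧ ∀ m : ℕ, ∃ (N : ℕ) (C : ℝ), ∀ p,
    ‖iteratedFDeriv ℝ m f p‖ ≤ C * (1 + ‖p.2‖) ^ N

theorem SlowGrowth.hasTemperateGrowth {f : X × Y → V} (hf : SlowGrowth f) :
    f.HasTemperateGrowth := by
  refine ⟨hf.1, fun m => ?_⟩
  obtain ⟨N, C, hC⟩ := hf.2 m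
  refine ⟨N, |C|, fun p => (hC p).trans ?_⟩
  gcongr
  · exact le_abs_self _
  · exact norm_snd_le p

theorem SlowGrowth.exists_uniform {f : X × Y → V} (hf : SlowGrowth f) (m : ℕ) :
    ∃ (N : ℕ) (C : ℝ), 0 ≤ C ∧ ∀ i ≤ m, ∀ p, ‖iteratedFDeriv ℝ i f p‖ ≤ C * (1 + ‖p.2‖) ^ N := by
  choose N C h using hf.2
  refine ⟨∑ i ∈ Finset.range (m + 1), N i, ∑ i ∈ Finset.range (m + 1), |C i|, by positivity,
    fun i hi p => (h i p).trans ?_⟩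
  have hi' : i ∈ Finset.range (m + 1) := by simpa [Nat.lt_succ_iff] using hi
  gcongr
  · exact (le_abs_self _).trans
      (Finset.single_le_sum (f := fun i => |C i|) (fun _ _ => abs_nonneg _) hi')
  · simp
  · exact Finset.single_le_sum (f := N) (fun _ _ => Nat.zero_le _) hi'

theorem SlowGrowth.add {f g : X × Y → V} (hf : SlowGrowth f) (hg : SlowGrowth g) :
    SlowGrowth (fun p => f p + g p) := by
  refine ⟨hf.1.add hg.1, fun m => ?_⟩
  obtain ⟨N₁, C₁, h₁0, h₁⟩ := hf.exists_uniform m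
  obtain ⟨N₂, C₂, h₂0, h₂⟩ := hg.exists_uniform m
  refine ⟨N₁ + N₂, C₁ + C₂, fun p => ?_⟩
  have := iteratedFDeriv_add_apply (hf.1.contDiffAt.of_le (m := m) (x := p) (mod_cast le_top))
    (hg.1.contDiffAt.of_le (mod_cast le_top))
  change ‖iteratedFDeriv ℝ m (f + g) p‖ ≤ _
  rw [this, add_mul]
  have one : 1 ≤ 1 + ‖p.2‖ := by simp
  refine (norm_add_le _ _).trans ?_
  gcongr ?_ + ?_
  · refine (h₁ m le_rfl p).trans ?_
    gcongr
    · omega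
  · refine (h₂ m le_rfl p).trans ?_
    gcongr
    · omega

theorem SlowGrowth.bilinear {U : Type} [NormedAddCommGroup U] [NormedSpace ℝ U]
    (B : V →L[ℝ] W →L[ℝ] U) {f : X × Y → V} {g : X × Y → W}
    (hf : SlowGrowth f) (hg : SlowGrowth g) : SlowGrowth (fun p => B (f p) (g p)) := by
  refine ⟨B.isBoundedBilinearMap.contDiff.comp (hf.1.prodMk hg.1), fun m => ?_⟩
  obtain ⟨N₁, C₁, h₁0, h₁⟩ := hf.exists_uniform m
  obtain ⟨N₂, C₂, h₂0, h₂⟩ := hg.exists_uniform m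
  refine ⟨N₁ + N₂, ‖B‖ * ∑ i ∈ Finset.range (m + 1), ((m.choose i) * C₁ * C₂), fun p => ?_⟩
  refine (B.norm_iteratedFDeriv_le_of_bilinear hf.1 hg.1 p (mod_cast le_top)).trans ?_
  rw [mul_assoc, Finset.sum_mul]
  refine mul_le_mul_of_nonneg_left (Finset.sum_le_sum fun i hi => ?_) (ContinuousLinearMap.opNorm_nonneg B)
  calc _ ≤ (m.choose i) * (C₁ * (1 + ‖p.2‖) ^ N₁) * (C₂ * (1 + ‖p.2‖) ^ N₂) := by
        gcongr
        · exact h₁ i (by simp only [Finset.mem_range] at hi; omega) p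
        · exact h₂ _ (by omega) p
    _ = _ := by rw [pow_add]; ring

theorem SlowGrowth.clm_comp (L : V →L[ℝ] W) {f : X × Y → V} (hf : SlowGrowth f) :
    SlowGrowth (fun p => L (f p)) := by
  refine ⟨L.contDiff.comp hf.1, fun m => ?_⟩
  obtain ⟨N, C, hC⟩ := hf.2 m
  refine ⟨N, ‖L‖ * C, fun p => ?_⟩
  refine (L.norm_iteratedFDeriv_comp_left hf.1.contDiffAt (mod_cast le_top)).trans ?_
  rw [mul_assoc]
  gcongr
  exact hC p

theorem SlowGrowth.fderiv {f : X × Y → V} (hf : SlowGrowth f) : SlowGrowth (fderiv ℝ f) := by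
  refine ⟨hf.1.fderiv_right (m := ∞) le_rfl, fun m => ?_⟩
  obtain ⟨N, C, hC⟩ := hf.2 (m + 1)
  exact ⟨N, C, fun p => by rw [norm_iteratedFDeriv_fderiv]; exact hC p⟩

theorem SlowGrowth.dFst {f : X × Y → V} (hf : SlowGrowth f) : SlowGrowth (dFst f) :=
  hf.fderiv.clm_comp ((ContinuousLinearMap.compL ℝ X (X × Y) V).flip (ContinuousLinearMap.inl ℝ X Y))

theorem SlowGrowth.comp_snd {g : Y → V} (hg : g.HasTemperateGrowth) :
    SlowGrowth (fun p : X × Y => g p.2) := by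
  refine ⟨hg.1.comp contDiff_snd, fun m => ?_⟩
  obtain ⟨N, C, hC⟩ := hg.2 m
  refine ⟨N, C * ‖ContinuousLinearMap.snd ℝ X Y‖ ^ m, fun p => ?_⟩
  have := (ContinuousLinearMap.snd ℝ X Y).iteratedFDeriv_comp_right (i := m) hg.1 p
    (mod_cast le_top)
  change ‖iteratedFDeriv ℝ m (g ∘ ContinuousLinearMap.snd ℝ X Y) p‖ ≤ _
  rw [this]
  refine (ContinuousMultilinearMap.norm_compContinuousLinearMap_le _ _).trans ?_
  simp only [Finset.prod_const, Finset.card_univ, Fintype.card_fin]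
  rw [mul_right_comm]
  gcongr
  exact hC p.2

end JointGrowth

theorem IsSymbol.slowGrowth {n : ℕ} {d ρ δ : ℝ} {a : Rn n → Rn n → ℂ} (ha : IsSymbol d ρ δ a) :
    SlowGrowth (fun p : Rn n × Rn n => a p.1 p.2) := by
  refine ⟨ha.1, fun m => IterSndBound.exists_iteratedFDeriv_le m ha.1 fun j =>
    MixedBound.iterSndBound j ha.1 fun k l => ?_⟩
  obtain ⟨C, hC⟩ := ha.2 k l
  -- Rounding the real order up to a natural number only weakens the bound; a negative order becomes
  -- 0.
  refine ⟨⌈d - ρ * k + δ * l⌉₊, |C|, fun x ξ => (hC x ξ).trans ?_⟩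
  rw [← Real.rpow_natCast]
  gcongr
  · exact le_abs_self _
  · simp
  · exact Nat.le_ceil _

open MeasureTheory

/-! ### Differentiation under the integral sign. -/

section ParametricIntegral

variable {P V W : Type} {n : ℕ} [NormedAddCommGroup P] [NormedSpace ℝ P]
  [NormedAddCommGroup V] [NormedSpace ℝ V] [NormedAddCommGroup W] [NormedSpace ℝ W]

/-- Smooth functions all of whose derivatives decay rapidly in the second variable and grow at most
polynomially in the first. -/
def DecaySnd (H : P × Rn n → V) : Prop :=
  ContDiff ℝ ∞ H ∧ ∀ m k : ℕ, ∃ (N : ℕ) (C : ℝ), 0 ≤ C ∧ ∀ p,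
    ‖iteratedFDeriv ℝ m H p‖ * (1 + ‖p.2‖) ^ k ≤ C * (1 + ‖p.1‖) ^ N

theorem DecaySnd.clm_comp (L : V →L[ℝ] W) {H : P × Rn n → V} (hH : DecaySnd H) :
    DecaySnd (fun p => L (H p)) := by
  refine ⟨L.contDiff.comp hH.1, fun m k => ?_⟩
  obtain ⟨N, C, C0, hC⟩ := hH.2 m k
  refine ⟨N, ‖L‖ * C, by positivity, fun p => ?_⟩
  calc _ ≤ ‖L‖ * ‖iteratedFDeriv ℝ m H p‖ * (1 + ‖p.2‖) ^ k := by
        gcongr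
        exact L.norm_iteratedFDeriv_comp_left hH.1.contDiffAt (mod_cast le_top)
    _ ≤ _ := by
        rw [mul_assoc, mul_assoc]
        exact mul_le_mul_of_nonneg_left (hC p) L.opNorm_nonneg

theorem DecaySnd.fderiv {H : P × Rn n → V} (hH : DecaySnd H) : DecaySnd (fderiv ℝ H) := by
  refine ⟨hH.1.fderiv_right (m := ∞) le_rfl, fun m k => ?_⟩
  obtain ⟨N, C, C0, hC⟩ := hH.2 (m + 1) k
  exact ⟨N, C, C0, fun p => by rw [norm_iteratedFDeriv_fderiv]; exact hC p⟩

theorem DecaySnd.dFst {H : P × Rn n → V} (hH : DecaySnd H) : DecaySnd (dFst H) :=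
  hH.fderiv.clm_comp
    ((ContinuousLinearMap.compL ℝ P (P × Rn n) V).flip (ContinuousLinearMap.inl ℝ P (Rn n)))

/-- Supplies one integrable majorant for all parameters in a ball, as dominated differentiation
requires. -/
theorem DecaySnd.exists_norm_le {H : P × Rn n → V} (hH : DecaySnd H) (R : ℝ) :
    ∃ C : ℝ, ∀ p y, ‖p‖ ≤ R →
      ‖H (p, y)‖ ≤ C * (1 + ‖y‖) ^ (-((volume : Measure (Rn n)).integrablePower : ℝ)) := by
  obtain ⟨N, C, C0, hC⟩ := hH.2 0 (volume : Measure (Rn n)).integrablePower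
  refine ⟨C * (1 + R) ^ N, fun p y hp => ?_⟩
  have h := hC (p, y)
  simp only [norm_iteratedFDeriv_zero] at h
  rw [Real.rpow_neg (by positivity), Real.rpow_natCast, ← div_eq_mul_inv,
    le_div_iff₀ (by positivity)]
  refine h.trans ?_
  gcongr

theorem DecaySnd.integrable {H : P × Rn n → V} (hH : DecaySnd H) (p : P) :
    Integrable (fun y => H (p, y)) := by
  obtain ⟨C, hC⟩ := hH.exists_norm_le ‖p‖
  refine Integrable.mono' ((volume : Measure (Rn n)).integrable_pow_neg_integrablePower.const_mul C)
    ?_ (ae_of_all _ fun y => hC p y le_rfl)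
  exact (hH.1.continuous.comp (Continuous.prodMk_right p)).aestronglyMeasurable

theorem DecaySnd.hasFDerivAt_integral {H : P × Rn n → V} (hH : DecaySnd H) (p : P) :
    HasFDerivAt (fun q => ∫ y, H (q, y)) (∫ y, TypeOneOne.dFst H (p, y)) p := by
  obtain ⟨C, hC⟩ := hH.dFst.exists_norm_le (‖p‖ + 1)
  refine hasFDerivAt_integral_of_dominated_of_fderiv_le (F' := fun q y => TypeOneOne.dFst H (q, y))
    (Metric.ball_mem_nhds p one_pos)
    (.of_forall fun q => (hH.integrable q).aestronglyMeasurable) (hH.integrable p)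
    (hH.dFst.integrable p).aestronglyMeasurable
    (ae_of_all _ fun y q hq => hC q y ?_)
    ((volume : Measure (Rn n)).integrable_pow_neg_integrablePower.const_mul C)
    (ae_of_all _ fun y q _ => hasFDerivAt_slice_fst hH.1 q y)
  have := norm_le_norm_add_norm_sub' q p
  rw [mem_ball_iff_norm] at hq
  linarith

theorem integral_isometry_comp (e : V ≃ₗᵢ[ℝ] W) (f : Rn n → V) :
    ∫ y, e (f y) = e (∫ y, f y) :=
  e.toContinuousLinearEquiv.integral_comp_comm f

/-- The decay class is stable under `dFst`, so one differentiation under the integral can be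
iterated. Carrying the integrand `Hm` through the induction identifies it with the slice derivative.
-/
theorem DecaySnd.exists_iteratedFDeriv_integral {H : P × Rn n → V} (hH : DecaySnd H) (m : ℕ) :
    ∃ Hm : P × Rn n → (P [×m]→L[ℝ] V), DecaySnd Hm ∧
      (∀ p y, Hm (p, y) = iteratedFDeriv ℝ m (fun q => H (q, y)) p) ∧
      (∀ p, iteratedFDeriv ℝ m (fun q => ∫ y, H (q, y)) p = ∫ y, Hm (p, y)) := by
  induction m with
  | zero =>
    let e := (continuousMultilinearCurryFin0 ℝ P V).symm
    refine ⟨fun q => e (H q), hH.clm_comp e.toContinuousLinearEquiv.toContinuousLinearMap,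
      fun p y => rfl, fun p => ?_⟩
    exact (integral_isometry_comp e _).symm
  | succ m ih =>
    obtain ⟨Hm, h1, h2, h3⟩ := ih
    let e := (continuousMultilinearCurryLeftEquiv ℝ (fun _ : Fin (m + 1) => P) V).symm
    refine ⟨fun q => e (TypeOneOne.dFst Hm q),
      h1.dFst.clm_comp e.toContinuousLinearEquiv.toContinuousLinearMap, fun p y => ?_, fun p => ?_⟩
    · have : iteratedFDeriv ℝ m (fun q => H (q, y)) = fun p => Hm (p, y) :=
        funext fun p => (h2 p y).symm
      rw [iteratedFDeriv_succ_eq_comp_left, this]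
      simp only [Function.comp]
      rw [(hasFDerivAt_slice_fst h1.1 p y).fderiv]
    · rw [iteratedFDeriv_succ_eq_comp_left, funext h3]
      simp only [Function.comp]
      rw [(h1.hasFDerivAt_integral p).fderiv]
      exact (integral_isometry_comp (V := P →L[ℝ] P [×m]→L[ℝ] V)
        (W := P [×(m + 1)]→L[ℝ] V) e _).symm

theorem DecaySnd.contDiff_integral {H : P × Rn n → V} (hH : DecaySnd H) :
    ContDiff ℝ ∞ (fun q => ∫ y, H (q, y)) := by
  refine contDiff_of_differentiable_iteratedFDeriv fun m _ => ?_
  obtain ⟨Hm, h1, -, h3⟩ := hH.exists_iteratedFDeriv_integral m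
  rw [funext h3]
  exact fun p => (h1.hasFDerivAt_integral p).differentiableAt

theorem DecaySnd.norm_iteratedFDeriv_integral_le {H : P × Rn n → V} (hH : DecaySnd H) (m : ℕ)
    (p : P) : ‖iteratedFDeriv ℝ m (fun q => ∫ y, H (q, y)) p‖ ≤
      ∫ y, ‖iteratedFDeriv ℝ m (fun q => H (q, y)) p‖ := by
  obtain ⟨Hm, h1, h2, h3⟩ := hH.exists_iteratedFDeriv_integral m
  rw [h3]
  simp_rw [← h2]
  exact norm_integral_le_integral_norm _

theorem norm_iteratedFDeriv_slice_snd_le {Y : Type} [NormedAddCommGroup Y] [NormedSpace ℝ Y]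
    {f : P × Y → V} (hf : ContDiff ℝ ∞ f) (l : ℕ) (x : P) (η : Y) :
    ‖iteratedFDeriv ℝ l (fun y => f (x, y)) η‖ ≤ ‖iteratedFDeriv ℝ l f (x, η)‖ := by
  rw [iteratedFDeriv_slice_snd hf]
  refine (ContinuousMultilinearMap.norm_compContinuousLinearMap_le _ _).trans ?_
  refine mul_le_of_le_one_right (norm_nonneg _) (Finset.prod_le_one (fun _ _ => norm_nonneg _)
    fun _ _ => ContinuousLinearMap.norm_inr_le_one ℝ P Y)

theorem norm_iteratedFDeriv_comp_snd_le {Y : Type} [NormedAddCommGroup Y] [NormedSpace ℝ Y]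
    {g : Y → V} (hg : ContDiff ℝ ∞ g) (l : ℕ) (p : P × Y) :
    ‖iteratedFDeriv ℝ l (fun q : P × Y => g q.2) p‖ ≤ ‖iteratedFDeriv ℝ l g p.2‖ := by
  have := (ContinuousLinearMap.snd ℝ P Y).iteratedFDeriv_comp_right (i := l) hg p
    (mod_cast le_top)
  change ‖iteratedFDeriv ℝ l (g ∘ ContinuousLinearMap.snd ℝ P Y) p‖ ≤ _
  rw [this]
  refine (ContinuousMultilinearMap.norm_compContinuousLinearMap_le _ _).trans ?_
  refine mul_le_of_le_one_right (norm_nonneg _) (Finset.prod_le_one (fun _ _ => norm_nonneg _)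
    fun _ _ => ContinuousLinearMap.norm_snd_le ℝ P Y)

theorem one_add_norm_prod_le {X Y : Type} [NormedAddCommGroup X] [NormedAddCommGroup Y]
    (p : X × Y) :
    1 + ‖p‖ ≤ (1 + ‖p.1‖) * (1 + ‖p.2‖) := by
  have h1 := norm_nonneg p.1
  have h2 := norm_nonneg p.2
  have : ‖p‖ ≤ ‖p.1‖ + ‖p.2‖ := by
    rw [Prod.norm_def]; exact max_le (by linarith) (by linarith)
  nlinarith

/-- The joint weight (1 + |p|)^N splits into a factor in p.1, which is allowed, and a factor in p.2,
which the Schwartz function absorbs by k + N orders of decay. -/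
theorem DecaySnd.of_schwartz_mul {F : P × Rn n → ℂ} (hF : F.HasTemperateGrowth)
    (ρ : 𝓢(Rn n, ℂ)) : DecaySnd (fun p => ρ p.2 * F p) := by
  have hρ : ContDiff ℝ ∞ ρ := ρ.smooth ⊤
  have hρ' : ContDiff ℝ ∞ (fun q : P × Rn n => ρ q.2) := hρ.comp contDiff_snd
  refine ⟨hρ'.mul hF.1, fun m k => ?_⟩
  obtain ⟨N, C, C0, hC⟩ := hF.norm_iteratedFDeriv_le_uniform m
  set D := 2 ^ (k + N) * (Finset.Iic (k + N, m)).sup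
    (fun m => SchwartzMap.seminorm ℝ m.1 m.2) ρ with hD
  have D0 : 0 ≤ D := by positivity
  have hDb : ∀ i ≤ m, ∀ y, (1 + ‖y‖) ^ (k + N) * ‖iteratedFDeriv ℝ i ρ y‖ ≤ D := fun i hi y =>
    SchwartzMap.one_add_le_sup_seminorm_apply (m := (k + N, m)) le_rfl hi ρ y
  refine ⟨N, ∑ i ∈ Finset.range (m + 1), ((m.choose i) * D * C), by positivity, fun p => ?_⟩
  have h1 := norm_iteratedFDeriv_mul_le hρ' hF.1 p (n := m) (mod_cast le_top)
  refine (mul_le_mul_of_nonneg_right h1 (by positivity)).trans ?_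
  rw [Finset.sum_mul, Finset.sum_mul]
  refine Finset.sum_le_sum fun i hi => ?_
  have hi' : i ≤ m := by simp only [Finset.mem_range] at hi; omega
  have a1 := norm_iteratedFDeriv_comp_snd_le (P := P) hρ i p
  have a2 := hC (m - i) (by omega) p
  have a3 : (1 + ‖p‖) ^ N ≤ (1 + ‖p.1‖) ^ N * (1 + ‖p.2‖) ^ N := by
    rw [← mul_pow]
    exact pow_le_pow_left₀ (by positivity) (one_add_norm_prod_le p) N
  calc _ ≤ (m.choose i) * ‖iteratedFDeriv ℝ i ρ p.2‖ *
        (C * ((1 + ‖p.1‖) ^ N * (1 + ‖p.2‖) ^ N)) * (1 + ‖p.2‖) ^ k := by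
        gcongr
        exact a2.trans (by gcongr)
    _ = (m.choose i) * ((1 + ‖p.2‖) ^ (k + N) * ‖iteratedFDeriv ℝ i ρ p.2‖) * C *
        (1 + ‖p.1‖) ^ N := by rw [pow_add]; ring
    _ ≤ _ := by
        gcongr
        exact hDb i hi' _

end ParametricIntegral

/-! ### Temperate growth of the phase factor. -/

section Phase

variable {n : ℕ}

/-- The phase factor `e^{2πi x·η}`. -/
def phase (p : Rn n × Rn n) : ℂ :=
  Complex.exp (2 * Real.pi * Complex.I * (inner ℝ p.1 p.2 : ℝ))

theorem hasTemperateGrowth_cexp_I :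
    (fun t : ℝ => Complex.exp (2 * Real.pi * Complex.I * t)).HasTemperateGrowth := by
  have hd : ∀ m : ℕ, iteratedDeriv m (fun t : ℝ => Complex.exp (2 * Real.pi * Complex.I * t)) =
      fun t : ℝ => (2 * Real.pi * Complex.I) ^ m * Complex.exp (2 * Real.pi * Complex.I * t) := by
    intro m
    induction m with
    | zero => simp
    | succ m ih =>
      rw [iteratedDeriv_succ, ih]
      ext t
      have h1 : HasDerivAt (fun t : ℝ => 2 * Real.pi * Complex.I * (t : ℂ))
          (2 * Real.pi * Complex.I * 1) t := (Complex.ofRealCLM.hasDerivAt (x := t)).const_mul _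
      rw [(h1.cexp.const_mul _).deriv]
      ring
  refine ⟨(contDiff_const.mul Complex.ofRealCLM.contDiff).cexp, fun m => ⟨0, (2 * Real.pi) ^ m, fun t => ?_⟩⟩
  rw [norm_iteratedFDeriv_eq_norm_iteratedDeriv, hd, norm_mul, norm_pow]
  have : ‖Complex.exp (2 * Real.pi * Complex.I * t)‖ = 1 := by
    rw [Complex.norm_exp]; simp
  rw [this]
  simp [abs_of_pos Real.pi_pos]

theorem hasTemperateGrowth_phase : (phase (n := n)).HasTemperateGrowth := by
  have h : (fun p : Rn n × Rn n => (inner ℝ p.1 p.2 : ℝ)).HasTemperateGrowth :=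
    (innerSL ℝ (E := Rn n)).bilinear_hasTemperateGrowth
      (ContinuousLinearMap.fst ℝ (Rn n) (Rn n)).hasTemperateGrowth
      (ContinuousLinearMap.snd ℝ (Rn n) (Rn n)).hasTemperateGrowth
  exact hasTemperateGrowth_cexp_I.comp h

end Phase

/-! ### Operators with slowly growing symbols preserve Schwartz functions. -/

section OscillatoryIntegral

variable {n : ℕ}

/-- The oscillatory integral `∫ e^{2πi x·η} ψ(η) G(x, η) dη`. -/
def oscInt (ψ : 𝓢(Rn n, ℂ)) (G : Rn n × Rn n → ℂ) (x : Rn n) : ℂ :=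
  ∫ η, ψ η * (phase (x, η) * G (x, η))

theorem SlowGrowth.decaySnd {G : Rn n × Rn n → ℂ} (hG : SlowGrowth G) (ψ : 𝓢(Rn n, ℂ)) :
    DecaySnd (fun p : Rn n × Rn n => ψ p.2 * (phase p * G p)) :=
  DecaySnd.of_schwartz_mul (hasTemperateGrowth_phase.mul hG.hasTemperateGrowth) ψ

theorem contDiff_oscInt {G : Rn n × Rn n → ℂ} (hG : SlowGrowth G) (ψ : 𝓢(Rn n, ℂ)) :
    ContDiff ℝ ∞ (oscInt ψ G) :=
  (hG.decaySnd ψ).contDiff_integral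

/-- The amplitude of the derivative of an oscillatory integral in the direction `h`. -/
def derivAmp (G : Rn n × Rn n → ℂ) (h : Rn n) (p : Rn n × Rn n) : ℂ :=
  2 * Real.pi * Complex.I * (inner ℝ h p.2 : ℝ) * G p + dFst G p h

/-- Differentiating the phase in x costs only a factor linear in η, so amplitudes of slow growth are
stable under differentiation of the integral. -/
theorem SlowGrowth.derivAmp {G : Rn n × Rn n → ℂ} (hG : SlowGrowth G) (h : Rn n) :
    SlowGrowth (derivAmp G h) := by
  have h1 : (fun η : Rn n => 2 * Real.pi * Complex.I * ((inner ℝ h η : ℝ) : ℂ)).HasTemperateGrowth :=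
    (Function.HasTemperateGrowth.const _).mul
      ((Complex.ofRealCLM.comp (innerSL ℝ h)).hasTemperateGrowth)
  exact ((SlowGrowth.comp_snd h1).bilinear (ContinuousLinearMap.mul ℝ ℂ) hG).add
    (hG.dFst.clm_comp (ContinuousLinearMap.apply ℝ ℂ h))

theorem hasFDerivAt_phase_fst (x η : Rn n) :
    HasFDerivAt (fun y => phase (y, η))
      (phase (x, η) • (2 * Real.pi * Complex.I) •
        (Complex.ofRealCLM.comp (innerSL ℝ η))) x := by
  have h1 : HasFDerivAt (fun y : Rn n => 2 * Real.pi * Complex.I * ((inner ℝ η y : ℝ) : ℂ))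
      ((2 * Real.pi * Complex.I) • (Complex.ofRealCLM.comp (innerSL ℝ η))) x :=
    (Complex.ofRealCLM.comp (innerSL ℝ η)).hasFDerivAt.const_mul _
  have h2 := h1.cexp
  have h3 : (fun y => phase (y, η)) =
      fun y => Complex.exp (2 * Real.pi * Complex.I * ((inner ℝ η y : ℝ) : ℂ)) := by
    ext y; simp only [phase, real_inner_comm]
  rw [h3, congrFun h3 x]
  exact h2

theorem fderiv_oscInt_apply {G : Rn n × Rn n → ℂ} (hG : SlowGrowth G) (ψ : 𝓢(Rn n, ℂ))
    (x h : Rn n) : fderiv ℝ (oscInt ψ G) x h = oscInt ψ (derivAmp G h) x := by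
  have hD := hG.decaySnd ψ
  have h1 := (hD.hasFDerivAt_integral x).fderiv
  change fderiv ℝ (fun q => ∫ y, ψ y * (phase (q, y) * G (q, y))) x h = _
  rw [h1, ContinuousLinearMap.integral_apply (hD.dFst.integrable x)]
  refine integral_congr_ae (ae_of_all _ fun η => ?_)
  have h2 := hasFDerivAt_slice_fst hD.1 x η
  have h3 := ((hasFDerivAt_phase_fst x η).mul (hasFDerivAt_slice_fst hG.1 x η)).const_mul (ψ η)
  dsimp only
  rw [h2.unique h3]
  simp [derivAmp, real_inner_comm]
  ring

theorem fderiv_oscInt {G : Rn n × Rn n → ℂ} (hG : SlowGrowth G) (ψ : 𝓢(Rn n, ℂ)) :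
    fderiv ℝ (oscInt ψ G) = fun x => ∑ i : Fin n,
      ContinuousLinearMap.smulRightL ℝ (Rn n) ℂ (EuclideanSpace.proj i)
        (oscInt ψ (derivAmp G (EuclideanSpace.single i 1)) x) := by
  ext x h
  have hh : h = ∑ i : Fin n, h i • EuclideanSpace.single i (1 : ℝ) := by
    ext j; simp [Pi.single_apply]
  conv_lhs => rw [hh]
  rw [map_sum]
  simp_rw [map_smul]
  simp [fderiv_oscInt_apply hG]

/-- The product of a Schwartz function with a slice of a function of slow growth. -/
def sliceMul (ψ : 𝓢(Rn n, ℂ)) (G : Rn n × Rn n → ℂ) (x : Rn n) : 𝓢(Rn n, ℂ) :=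
  SchwartzMap.smulLeftCLM ℂ (fun η => G (x, η)) ψ

theorem SlowGrowth.slice {G : Rn n × Rn n → ℂ} (hG : SlowGrowth G) (x : Rn n) :
    (fun η => G (x, η)).HasTemperateGrowth := by
  refine ⟨hG.1.comp (contDiff_prodMk_right x), fun m => ?_⟩
  obtain ⟨N, C, hC⟩ := hG.2 m
  exact ⟨N, C, fun η => (norm_iteratedFDeriv_slice_snd_le hG.1 m x η).trans (hC (x, η))⟩

theorem SlowGrowth.sliceMul_apply {G : Rn n × Rn n → ℂ} (hG : SlowGrowth G) (ψ : 𝓢(Rn n, ℂ))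
    (x η : Rn n) : sliceMul ψ G x η = G (x, η) * ψ η :=
  SchwartzMap.smulLeftCLM_apply_apply (hG.slice x) ψ η

/-- Uniformity in x holds because the amplitude grows in η alone, where ψ decays. -/
theorem SlowGrowth.exists_seminorm_sliceMul_le {G : Rn n × Rn n → ℂ} (hG : SlowGrowth G)
    (ψ : 𝓢(Rn n, ℂ)) (k l : ℕ) :
    ∃ C : ℝ, 0 ≤ C ∧ ∀ x, SchwartzMap.seminorm ℂ k l (sliceMul ψ G x) ≤ C := by
  obtain ⟨N, C, C0, hC⟩ := hG.exists_uniform l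
  set D := 2 ^ (k + N) * (Finset.Iic (k + N, l)).sup
    (fun m => SchwartzMap.seminorm ℝ m.1 m.2) ψ with hD
  have D0 : 0 ≤ D := by positivity
  have hDb : ∀ i ≤ l, ∀ y, (1 + ‖y‖) ^ (k + N) * ‖iteratedFDeriv ℝ i ψ y‖ ≤ D := fun i hi y =>
    SchwartzMap.one_add_le_sup_seminorm_apply (m := (k + N, l)) le_rfl hi ψ y
  refine ⟨∑ i ∈ Finset.range (l + 1), ((l.choose i) * C * D), by positivity, fun x => ?_⟩
  refine SchwartzMap.seminorm_le_bound ℂ k l _ (by positivity) fun η => ?_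
  have e : (sliceMul ψ G x : Rn n → ℂ) = fun η => G (x, η) * ψ η :=
    funext (hG.sliceMul_apply ψ x)
  rw [e]
  have h1 := norm_iteratedFDeriv_mul_le (hG.slice x).1 (ψ.smooth ⊤) η (n := l) (mod_cast le_top)
  refine (mul_le_mul_of_nonneg_left h1 (by positivity)).trans ?_
  rw [Finset.mul_sum]
  refine Finset.sum_le_sum fun i hi => ?_
  have hi' : i ≤ l := by simp only [Finset.mem_range] at hi; omega
  have a1 := (norm_iteratedFDeriv_slice_snd_le hG.1 i x η).trans (hC i hi' (x, η))
  have a2 : ‖η‖ ^ k ≤ (1 + ‖η‖) ^ k := by gcongr; simp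
  calc _ ≤ (1 + ‖η‖) ^ k * ((l.choose i) * (C * (1 + ‖η‖) ^ N) *
        ‖iteratedFDeriv ℝ (l - i) ψ η‖) := by gcongr
    _ = (l.choose i) * C * ((1 + ‖η‖) ^ (k + N) * ‖iteratedFDeriv ℝ (l - i) ψ η‖) := by
        rw [pow_add]; ring
    _ ≤ _ := by
        gcongr
        exact hDb _ (by omega) _

theorem oscInt_eq_fourierInv {G : Rn n × Rn n → ℂ} (hG : SlowGrowth G) (ψ : 𝓢(Rn n, ℂ))
    (x : Rn n) : oscInt ψ G x = 𝓕⁻ (sliceMul ψ G x) x := by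
  rw [SchwartzMap.fourierInv_coe, Real.fourierInv_eq']
  refine integral_congr_ae (ae_of_all _ fun η => ?_)
  dsimp only
  rw [hG.sliceMul_apply, phase, smul_eq_mul, real_inner_comm]
  push_cast
  rw [show (2 * Real.pi * (inner ℝ η x : ℝ) * Complex.I : ℂ) =
    2 * Real.pi * Complex.I * (inner ℝ η x : ℝ) by ring]
  ring

/-- Freeze x in the amplitude: the integral becomes the inverse Fourier transform of `sliceMul ψ G
x`, evaluated at the same x. Continuity of that transform on 𝓢 bounds its weighted sup norm by
finitely many seminorms of the slice, and these are bounded independently of x. -/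
theorem exists_pow_mul_oscInt_le {G : Rn n × Rn n → ℂ} (hG : SlowGrowth G) (ψ : 𝓢(Rn n, ℂ))
    (k : ℕ) : ∃ C : ℝ, ∀ x, ‖x‖ ^ k * ‖oscInt ψ G x‖ ≤ C := by
  let q : Seminorm ℂ 𝓢(Rn n, ℂ) := (SchwartzMap.seminorm ℂ k 0).comp
    (FourierTransform.fourierInvCLM ℂ 𝓢(Rn n, ℂ)).toLinearMap
  have hq : Continuous q :=
    ((schwartz_withSeminorms ℂ (Rn n) ℂ).continuous_seminorm (k, 0)).comp
      (FourierTransform.fourierInvCLM ℂ 𝓢(Rn n, ℂ)).continuous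
  obtain ⟨s, C, -, hC⟩ := Seminorm.bound_of_continuous (schwartz_withSeminorms ℂ (Rn n) ℂ) q hq
  choose D D0 hD using fun i : ℕ × ℕ => hG.exists_seminorm_sliceMul_le ψ i.1 i.2
  refine ⟨C * ∑ i ∈ s, D i, fun x => ?_⟩
  rw [oscInt_eq_fourierInv hG]
  refine (SchwartzMap.norm_pow_mul_le_seminorm ℂ (𝓕⁻ (sliceMul ψ G x)) k x).trans ?_
  refine (hC (sliceMul ψ G x)).trans ?_
  change (C : ℝ) * _ ≤ _
  refine mul_le_mul_of_nonneg_left ?_ C.2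
  refine Seminorm.finset_sup_apply_le (Finset.sum_nonneg fun i _ => D0 i) fun i hi => ?_
  exact (hD i x).trans (Finset.single_le_sum (fun j _ => D0 j) hi)

theorem exists_pow_mul_iteratedFDeriv_oscInt_le (ψ : 𝓢(Rn n, ℂ)) (k m : ℕ) :
    ∀ {G : Rn n × Rn n → ℂ}, SlowGrowth G →
      ∃ C : ℝ, ∀ x, ‖x‖ ^ k * ‖iteratedFDeriv ℝ m (oscInt ψ G) x‖ ≤ C := by
  induction m with
  | zero =>
    intro G hG
    simpa using exists_pow_mul_oscInt_le hG ψ k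
  | succ m ih =>
    intro G hG
    choose C hC using fun i : Fin n => ih (hG.derivAmp (EuclideanSpace.single i 1))
    let L : Fin n → ℂ →L[ℝ] (Rn n →L[ℝ] ℂ) := fun i =>
      ContinuousLinearMap.smulRightL ℝ (Rn n) ℂ (EuclideanSpace.proj i)
    refine ⟨∑ i, ‖L i‖ * C i, fun x => ?_⟩
    rw [← norm_iteratedFDeriv_fderiv, fderiv_oscInt hG]
    have hc : ∀ i : Fin n, ContDiff ℝ ∞ (oscInt ψ (derivAmp G (EuclideanSpace.single i 1))) :=
      fun i => contDiff_oscInt (hG.derivAmp _) ψ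
    have hs : iteratedFDeriv ℝ m (fun x => ∑ i : Fin n,
        L i (oscInt ψ (derivAmp G (EuclideanSpace.single i 1)) x)) x =
        ∑ i : Fin n, iteratedFDeriv ℝ m
          (L i ∘ (oscInt ψ (derivAmp G (EuclideanSpace.single i 1)))) x :=
      iteratedFDeriv_fun_sum_apply fun i _ =>
        (((L i).contDiff.comp (hc i)).of_le (mod_cast le_top)).contDiffAt
    rw [hs]
    calc _ ≤ ‖x‖ ^ k * ∑ i : Fin n, ‖L i‖ *
          ‖iteratedFDeriv ℝ m (oscInt ψ (derivAmp G (EuclideanSpace.single i 1))) x‖ := by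
          gcongr
          refine norm_sum_le_of_le _ fun i _ => ?_
          exact (L i).norm_iteratedFDeriv_comp_left (hc i).contDiffAt (mod_cast le_top)
      _ = ∑ i : Fin n, ‖L i‖ * (‖x‖ ^ k *
          ‖iteratedFDeriv ℝ m (oscInt ψ (derivAmp G (EuclideanSpace.single i 1))) x‖) := by
          rw [Finset.mul_sum]
          exact Finset.sum_congr rfl fun i _ => by ring
      _ ≤ _ := Finset.sum_le_sum fun i _ =>
          mul_le_mul_of_nonneg_left (hC i x) (L i).opNorm_nonneg

/-- The oscillatory integral as a Schwartz function. -/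
def oscIntSchwartz (ψ : 𝓢(Rn n, ℂ)) {G : Rn n × Rn n → ℂ} (hG : SlowGrowth G) : 𝓢(Rn n, ℂ) where
  toFun := oscInt ψ G
  smooth' := contDiff_oscInt hG ψ
  decay' k m := exists_pow_mul_iteratedFDeriv_oscInt_le ψ k m hG

/-- The symbol in Mathlib's frequency variable. -/
def rescale (a : Rn n → Rn n → ℂ) (p : Rn n × Rn n) : ℂ := a p.1 ((2 * Real.pi) • p.2)

/-- The substitution ξ = 2πη produces the Jacobian (2π)ⁿ, which cancels the normalising factor. -/
theorem op_eq_oscInt (a : Rn n → Rn n → ℂ) (v : 𝓢(Rn n, ℂ)) (x : Rn n) :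
    op a v x = oscInt (𝓕 v) (rescale a) x := by
  have h2 : (2 * Real.pi) ≠ 0 := by positivity
  have h1 := Measure.integral_comp_smul (volume : Measure (Rn n))
    (fun η => 𝓕 v η * (phase (x, η) * rescale a (x, η))) ((2 * Real.pi)⁻¹)
  have h3 : |(((2 * Real.pi)⁻¹ ^ n)⁻¹ : ℝ)| = (2 * Real.pi) ^ n := by
    rw [inv_pow, inv_inv, abs_of_pos (by positivity)]
  rw [finrank_euclideanSpace_fin, h3] at h1
  have h4 : ∫ ξ : Rn n, Complex.exp (Complex.I * (inner ℝ x ξ : ℝ)) * a x ξ * hat v ξ =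
      ∫ ξ : Rn n, 𝓕 v ((2 * Real.pi)⁻¹ • ξ) * (phase (x, (2 * Real.pi)⁻¹ • ξ) *
        rescale a (x, (2 * Real.pi)⁻¹ • ξ)) := by
    refine integral_congr_ae (ae_of_all _ fun ξ => ?_)
    dsimp only
    rw [hat, rescale, phase, smul_smul, mul_inv_cancel₀ h2, one_smul, inner_smul_right]
    have : (2 * Real.pi * Complex.I * (((2 * Real.pi)⁻¹ * inner ℝ x ξ : ℝ) : ℂ)) =
        Complex.I * (inner ℝ x ξ : ℝ) := by
      push_cast
      have : (2 * Real.pi : ℂ) ≠ 0 := by exact_mod_cast h2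
      field_simp
    rw [this]
    ring
  rw [op, h4, h1, oscInt, Complex.real_smul, ← mul_assoc, ← Complex.ofReal_mul,
    inv_mul_cancel₀ (by positivity)]
  simp

theorem SlowGrowth.rescale {a : Rn n → Rn n → ℂ}
    (ha : SlowGrowth (fun p : Rn n × Rn n => a p.1 p.2)) : SlowGrowth (rescale a) := by
  let L : (Rn n × Rn n) →L[ℝ] (Rn n × Rn n) :=
    (ContinuousLinearMap.fst ℝ (Rn n) (Rn n)).prod
      ((2 * Real.pi) • ContinuousLinearMap.snd ℝ (Rn n) (Rn n))
  have e : TypeOneOne.rescale a = (fun p : Rn n × Rn n => a p.1 p.2) ∘ L := rfl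
  refine ⟨e ▸ ha.1.comp L.contDiff, fun m => ?_⟩
  obtain ⟨N, C, hC⟩ := ha.2 m
  refine ⟨N, |C| * (2 * Real.pi) ^ N * ‖L‖ ^ m, fun p => ?_⟩
  rw [e, L.iteratedFDeriv_comp_right ha.1 p (mod_cast le_top)]
  refine (ContinuousMultilinearMap.norm_compContinuousLinearMap_le _ _).trans ?_
  simp only [Finset.prod_const, Finset.card_univ, Fintype.card_fin]
  rw [mul_right_comm]
  gcongr
  refine (hC (L p)).trans ?_
  rw [mul_assoc, ← mul_pow]
  have h2 : (L p).2 = (2 * Real.pi) • p.2 := rfl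
  have h3 : 1 + ‖(L p).2‖ ≤ 2 * Real.pi * (1 + ‖p.2‖) := by
    rw [h2, norm_smul, Real.norm_of_nonneg (by positivity)]
    nlinarith [Real.pi_gt_three, norm_nonneg p.2]
  gcongr
  exact le_abs_self _

end OscillatoryIntegral

/-! ### Extension to tempered distributions by transposition. -/

section Transpose

variable {n : ℕ}

/-- Functions of temperate growth on `ℝⁿ × ℝⁿ` that are supported in a ball of radius `R` in the
second variable. -/
structure FreqSupported {V : Type} [NormedAddCommGroup V] [NormedSpace ℝ V] (R : ℝ)
    (F : Rn n × Rn n → V) : Prop where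
  temperate : F.HasTemperateGrowth
  eq_zero : ∀ x η, R < ‖η‖ → F (x, η) = 0

theorem FreqSupported.decaySnd_swap {R : ℝ} {F : Rn n × Rn n → ℂ} (hF : FreqSupported R F)
    (φ : 𝓢(Rn n, ℂ)) : DecaySnd (fun p : Rn n × Rn n => φ p.2 * F (p.2, p.1)) :=
  DecaySnd.of_schwartz_mul (F := fun p : Rn n × Rn n => F (p.2, p.1))
    (hF.temperate.comp
      ((ContinuousLinearEquiv.prodComm ℝ (Rn n) (Rn n)).hasTemperateGrowth)) φ

theorem exists_integral_one_add_norm_pow_le (N : ℕ) :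
    ∃ (s : Finset (ℕ × ℕ)) (C : ℝ), 0 ≤ C ∧ ∀ φ : 𝓢(Rn n, ℂ),
      Integrable (fun x => (1 + ‖x‖) ^ N * ‖φ x‖) ∧
      ∫ x, (1 + ‖x‖) ^ N * ‖φ x‖ ≤ C * s.sup (schwartzSeminormFamily ℂ (Rn n) ℂ) φ := by
  set μ := (volume : Measure (Rn n)) with hμ
  -- The additional `integrablePower` orders of decay pay for integrability.
  set m : ℕ × ℕ := (N + μ.integrablePower, 0) with hm
  refine ⟨Finset.Iic m, 2 ^ m.1 * ∫ x : Rn n, (1 + ‖x‖) ^ (-(μ.integrablePower : ℝ)),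
    by positivity, fun φ => ?_⟩
  set D := 2 ^ m.1 * (Finset.Iic m).sup (schwartzSeminormFamily ℂ (Rn n) ℂ) φ with hD
  have hb : ∀ x, (1 + ‖x‖) ^ N * ‖φ x‖ ≤ D * (1 + ‖x‖) ^ (-(μ.integrablePower : ℝ)) := by
    intro x
    have h := SchwartzMap.one_add_le_sup_seminorm_apply (𝕜 := ℂ) (m := m) (k := m.1) (n := 0)
      le_rfl le_rfl φ x
    rw [Real.rpow_neg (by positivity), Real.rpow_natCast, ← div_eq_mul_inv,
      le_div_iff₀ (by positivity)]
    refine le_trans (le_of_eq ?_) h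
    rw [norm_iteratedFDeriv_zero, hm, pow_add]
    ring
  have hi := (μ.integrable_pow_neg_integrablePower).const_mul D
  have hi' : Integrable (fun x => (1 + ‖x‖) ^ N * ‖φ x‖) μ := by
    refine hi.mono' (Continuous.aestronglyMeasurable ?_) (ae_of_all _ fun x => ?_)
    · have := φ.continuous
      fun_prop
    · rw [Real.norm_of_nonneg (by positivity)]
      exact hb x
  refine ⟨hi', (integral_mono hi' hi hb).trans (le_of_eq ?_)⟩
  rw [integral_const_mul, hD]
  ring

theorem FreqSupported.exists_bound_transpose {R : ℝ} {F : Rn n × Rn n → ℂ}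
    (hF : FreqSupported R F) (k m : ℕ) :
    ∃ (s : Finset (ℕ × ℕ)) (C : ℝ), 0 ≤ C ∧ ∀ (φ : 𝓢(Rn n, ℂ)) (η : Rn n),
      ‖η‖ ^ k * ‖iteratedFDeriv ℝ m (fun η => ∫ x, φ x * F (x, η)) η‖ ≤
        C * s.sup (schwartzSeminormFamily ℂ (Rn n) ℂ) φ := by
  obtain ⟨N, C, C0, hC⟩ := hF.temperate.norm_iteratedFDeriv_le_uniform m
  obtain ⟨s, D, D0, hD⟩ := exists_integral_one_add_norm_pow_le (n := n) N
  refine ⟨s, |R| ^ k * (C * (1 + |R|) ^ N * D), by positivity, fun φ η => ?_⟩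
  -- Outside the closed ball the integral vanishes on a neighbourhood, hence with all derivatives;
  -- inside, the weight is at most |R|^k. The absolute value covers a negative R.
  rcases lt_or_ge R ‖η‖ with h | h
  · have h0 : (fun η => ∫ x, φ x * F (x, η)) =ᶠ[𝓝 η] fun _ => 0 := by
      filter_upwards [(isOpen_lt continuous_const continuous_norm).mem_nhds h] with ζ hζ
      simp [hF.eq_zero _ ζ hζ]
    have h1 := (h0.iteratedFDeriv ℝ m).eq_of_nhds
    have h2 : iteratedFDeriv ℝ m (fun _ : Rn n => (0 : ℂ)) η = 0 := by
      rw [iteratedFDeriv_fun_zero]; rfl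
    rw [h1, h2, norm_zero, mul_zero]
    positivity
  · have hR : ‖η‖ ≤ |R| := h.trans (le_abs_self R)
    have h1 := (hF.decaySnd_swap φ).norm_iteratedFDeriv_integral_le m η
    have h2 : ∀ x, ‖iteratedFDeriv ℝ m (fun q => φ x * F (x, q)) η‖ ≤
        C * (1 + |R|) ^ N * ((1 + ‖x‖) ^ N * ‖φ x‖) := by
      intro x
      have e : (fun q => φ x * F (x, q)) = fun q => φ x • F (x, q) := rfl
      have hs : ContDiff ℝ ∞ (fun q => F (x, q)) := hF.temperate.1.comp (contDiff_prodMk_right x)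
      rw [e, iteratedFDeriv_const_smul_apply' (hs.contDiffAt.of_le (mod_cast le_top)), norm_smul]
      calc _ ≤ ‖φ x‖ * (C * ((1 + ‖x‖) ^ N * (1 + |R|) ^ N)) := by
            gcongr
            refine (norm_iteratedFDeriv_slice_snd_le hF.temperate.1 m x η).trans
              ((hC m le_rfl (x, η)).trans ?_)
            rw [← mul_pow]
            gcongr
            exact (one_add_norm_prod_le (x, η)).trans (by dsimp only; gcongr)
        _ = _ := by ring
    have h3 : ∫ x, ‖iteratedFDeriv ℝ m (fun q => φ x * F (x, q)) η‖ ≤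
        C * (1 + |R|) ^ N * (D * s.sup (schwartzSeminormFamily ℂ (Rn n) ℂ) φ) := by
      calc _ ≤ ∫ x, C * (1 + |R|) ^ N * ((1 + ‖x‖) ^ N * ‖φ x‖) :=
            integral_mono_of_nonneg (ae_of_all _ fun x => norm_nonneg _)
              ((hD φ).1.const_mul _) (ae_of_all _ h2)
        _ ≤ _ := by
            rw [integral_const_mul]
            gcongr
            exact (hD φ).2
    calc _ ≤ |R| ^ k * (C * (1 + |R|) ^ N *
          (D * s.sup (schwartzSeminormFamily ℂ (Rn n) ℂ) φ)) := by
          gcongr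
          exact h1.trans h3
      _ = _ := by ring

/-- The map `φ ↦ ∫ F(x, ·) φ(x) dx` on Schwartz functions. -/
def transposeCLM {R : ℝ} {F : Rn n × Rn n → ℂ} (hF : FreqSupported R F) :
    𝓢(Rn n, ℂ) →L[ℂ] 𝓢(Rn n, ℂ) :=
  SchwartzMap.mkCLM (fun φ η => ∫ x, φ x * F (x, η))
    (fun φ ψ η => by
      rw [← integral_add ((hF.decaySnd_swap φ).integrable η) ((hF.decaySnd_swap ψ).integrable η)]
      simp [add_mul])
    (fun c φ η => by
      simp [mul_assoc, integral_const_mul])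
    (fun φ => (hF.decaySnd_swap φ).contDiff_integral)
    (fun p => hF.exists_bound_transpose p.1 p.2)

theorem transposeCLM_apply {R : ℝ} {F : Rn n × Rn n → ℂ} (hF : FreqSupported R F)
    (φ : 𝓢(Rn n, ℂ)) (η : Rn n) : transposeCLM hF φ η = ∫ x, φ x * F (x, η) := rfl

/-- The operator on tempered distributions with amplitude `F`: formally
`u ↦ ∫ F(·, η) (𝓕 u)(η) dη`. -/
def extOp {R : ℝ} {F : Rn n × Rn n → ℂ} (hF : FreqSupported R F) :
    𝓢'(Rn n, ℂ) →L[ℂ] 𝓢'(Rn n, ℂ) :=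
  (PointwiseConvergenceCLM.precomp ℂ (transposeCLM hF)).comp
    (FourierTransform.fourierCLM ℂ 𝓢'(Rn n, ℂ))

theorem extOp_apply {R : ℝ} {F : Rn n × Rn n → ℂ} (hF : FreqSupported R F) (u : 𝓢'(Rn n, ℂ))
    (φ : 𝓢(Rn n, ℂ)) : extOp hF u φ = (𝓕 u : 𝓢'(Rn n, ℂ)) (transposeCLM hF φ) := rfl

theorem integrable_prod_schwartz_mul {F : Rn n × Rn n → ℂ} (hF : F.HasTemperateGrowth)
    (φ ψ : 𝓢(Rn n, ℂ)) :
    Integrable (fun p : Rn n × Rn n => ψ p.1 * (φ p.2 * F (p.2, p.1)))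
      ((volume : Measure (Rn n)).prod volume) := by
  obtain ⟨N, C, C0, hC⟩ := hF.norm_iteratedFDeriv_le_uniform 0
  obtain ⟨s, D, D0, hD⟩ := exists_integral_one_add_norm_pow_le (n := n) N
  refine (((hD ψ).1.mul_prod (hD φ).1).const_mul C).mono'
    (Continuous.aestronglyMeasurable ?_) (ae_of_all _ fun p => ?_)
  · have h1 := φ.continuous
    have h2 := ψ.continuous
    have h3 := hF.1.continuous
    fun_prop
  · have h := hC 0 le_rfl (p.2, p.1)
    rw [norm_iteratedFDeriv_zero] at h
    have h' : (1 + ‖(p.2, p.1)‖) ^ N ≤ (1 + ‖p.2‖) ^ N * (1 + ‖p.1‖) ^ N := by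
      rw [← mul_pow]
      exact pow_le_pow_left₀ (by positivity) (one_add_norm_prod_le (p.2, p.1)) N
    rw [norm_mul, norm_mul]
    calc _ ≤ ‖ψ p.1‖ * (‖φ p.2‖ * (C * ((1 + ‖p.2‖) ^ N * (1 + ‖p.1‖) ^ N))) := by
          gcongr
          exact h.trans (by gcongr)
      _ = _ := by ring

theorem toDistr_apply (v φ : 𝓢(Rn n, ℂ)) : toDistr v φ = ∫ x, φ x * v x := rfl

/-- Fubini's theorem for φ(x) 𝓕v(η) F(x, η), which is integrable since both Schwartz factors decay.
-/
theorem extOp_toDistr {R : ℝ} {G : Rn n × Rn n → ℂ} (hG : SlowGrowth G)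
    (hF : FreqSupported R (fun p => phase p * G p)) (v : 𝓢(Rn n, ℂ)) :
    extOp hF (toDistr v) = toDistr (oscIntSchwartz (𝓕 v) hG) := by
  ext φ
  rw [extOp_apply, toDistr, TemperedDistribution.fourier_toTemperedDistributionCLM_eq,
    toDistr_apply, toDistr_apply]
  have h1 := integral_integral_swap
    (f := fun η x => (𝓕 v : 𝓢(Rn n, ℂ)) η * (φ x * (phase (x, η) * G (x, η))))
    (integrable_prod_schwartz_mul hF.temperate φ (𝓕 v : 𝓢(Rn n, ℂ)))
  calc _ = ∫ η, ∫ x, (𝓕 v : 𝓢(Rn n, ℂ)) η * (φ x * (phase (x, η) * G (x, η))) := by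
        refine integral_congr_ae (ae_of_all _ fun η => ?_)
        dsimp only
        rw [transposeCLM_apply, mul_comm, ← integral_const_mul]
    _ = ∫ x, ∫ η, (𝓕 v : 𝓢(Rn n, ℂ)) η * (φ x * (phase (x, η) * G (x, η))) := h1
    _ = _ := by
        refine integral_congr_ae (ae_of_all _ fun x => ?_)
        dsimp only
        change _ = φ x * oscInt (𝓕 v) G x
        rw [oscInt, ← integral_const_mul]
        exact integral_congr_ae (ae_of_all _ fun η => by dsimp only; ring)

end Transpose

open scoped BoundedContinuousFunction

/-! ### Slices F(x, ·) as a smooth function of x with values in bounded functions. -/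

section SliceMaps

variable {n : ℕ} {V W : Type} [NormedAddCommGroup V] [NormedSpace ℝ V]
  [NormedAddCommGroup W] [NormedSpace ℝ W] {R : ℝ} {G : Rn n × Rn n → V}

/-- Only |η| ≤ R contributes, so the growth in η goes into the constant and the bound is uniform in
η. -/
theorem FreqSupported.exists_norm_le (hG : FreqSupported R G) :
    ∃ (N : ℕ) (C : ℝ), 0 ≤ C ∧ ∀ x η, ‖G (x, η)‖ ≤ C * (1 + ‖x‖) ^ N := by
  obtain ⟨N, C, C0, hC⟩ := hG.temperate.norm_iteratedFDeriv_le_uniform 0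
  refine ⟨N, C * (1 + |R|) ^ N, by positivity, fun x η => ?_⟩
  rcases lt_or_ge R ‖η‖ with h | h
  · rw [hG.eq_zero x η h, norm_zero]
    positivity
  · have h1 := hC 0 le_rfl (x, η)
    rw [norm_iteratedFDeriv_zero] at h1
    refine h1.trans ?_
    rw [mul_assoc, ← mul_pow]
    gcongr
    refine (one_add_norm_prod_le (x, η)).trans ?_
    rw [mul_comm]
    dsimp only
    gcongr
    exact h.trans (le_abs_self R)

theorem FreqSupported.clm_comp (L : V →L[ℝ] W) (hG : FreqSupported R G) :
    FreqSupported R (fun p => L (G p)) :=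
  ⟨L.hasTemperateGrowth.comp hG.temperate, fun x η h => by rw [hG.eq_zero x η h, map_zero]⟩

theorem FreqSupported.eventually_eq_zero (hG : FreqSupported R G) {x η : Rn n} (h : R < ‖η‖) :
    G =ᶠ[𝓝 (x, η)] fun _ => 0 := by
  have : IsOpen {p : Rn n × Rn n | R < ‖p.2‖} :=
    isOpen_lt continuous_const continuous_snd.norm
  filter_upwards [this.mem_nhds h] with p hp
  exact hG.eq_zero p.1 p.2 hp

theorem FreqSupported.fderiv (hG : FreqSupported R G) : FreqSupported R (fderiv ℝ G) := by
  refine ⟨⟨hG.temperate.1.fderiv_right (m := ∞) le_rfl, fun m => ?_⟩, fun x η h => ?_⟩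
  · obtain ⟨N, C, hC⟩ := hG.temperate.2 (m + 1)
    exact ⟨N, C, fun p => by rw [norm_iteratedFDeriv_fderiv]; exact hC p⟩
  · rw [(hG.eventually_eq_zero h).fderiv_eq]
    simp

theorem FreqSupported.dFst (hG : FreqSupported R G) : FreqSupported R (dFst G) :=
  hG.fderiv.clm_comp ((ContinuousLinearMap.compL ℝ (Rn n) (Rn n × Rn n) V).flip
    (ContinuousLinearMap.inl ℝ (Rn n) (Rn n)))

theorem FreqSupported.dSnd (hG : FreqSupported R G) : FreqSupported R (dSnd G) :=
  hG.fderiv.clm_comp ((ContinuousLinearMap.compL ℝ (Rn n) (Rn n × Rn n) V).flip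
    (ContinuousLinearMap.inr ℝ (Rn n) (Rn n)))

/-- The slice `G(x, ·)` as a bounded continuous function. -/
def sliceBCF (hG : FreqSupported R G) (x : Rn n) : Rn n →ᵇ V :=
  BoundedContinuousFunction.ofNormedAddCommGroup (fun η => G (x, η))
    (hG.temperate.1.continuous.comp (Continuous.prodMk_right x))
    (hG.exists_norm_le.choose_spec.choose * (1 + ‖x‖) ^ hG.exists_norm_le.choose)
    (fun η => hG.exists_norm_le.choose_spec.choose_spec.2 x η)

theorem sliceBCF_apply (hG : FreqSupported R G) (x η : Rn n) : sliceBCF hG x η = G (x, η) := rfl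

/-- A bounded continuous function with values in `ℝⁿ →L V`, seen as a linear map with values in the
bounded continuous functions. -/
def swapBCF : (Rn n →ᵇ (Rn n →L[ℝ] V)) →L[ℝ] (Rn n →L[ℝ] (Rn n →ᵇ V)) :=
  LinearMap.mkContinuous₂
    (LinearMap.mk₂ ℝ
      (fun f h => (ContinuousLinearMap.apply ℝ V h).compLeftContinuousBounded (Rn n) f)
      (fun f g h => by ext η; simp) (fun c f h => by ext η; simp)
      (fun f h h' => by ext η; simp) (fun c f h => by ext η; simp)) 1
    (fun f h => by
      rw [one_mul]
      refine (BoundedContinuousFunction.norm_le (by positivity)).2 fun η => ?_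
      exact (f η).le_of_opNorm_le (f.norm_coe_le_norm η) h)

theorem swapBCF_apply (f : Rn n →ᵇ (Rn n →L[ℝ] V)) (h η : Rn n) : swapBCF f h η = f η h := rfl

theorem hasFDerivAt_sliceBCF (hG : FreqSupported R G) (x : Rn n) :
    HasFDerivAt (sliceBCF hG) (swapBCF (sliceBCF hG.dFst x)) x := by
  -- The remainder is controlled in sup norm: M bounds the second x-derivative on the unit ball
  -- around x, uniformly in η, and two mean value estimates give M|h|².
  obtain ⟨N, C, C0, hC⟩ := hG.dFst.dFst.exists_norm_le
  set M := C * (1 + (‖x‖ + 1)) ^ N with hM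
  have hM0 : 0 ≤ M := by positivity
  have key : ∀ h : Rn n, ‖h‖ ≤ 1 →
      ‖sliceBCF hG (x + h) - sliceBCF hG x - swapBCF (sliceBCF hG.dFst x) h‖ ≤ M * ‖h‖ ^ 2 := by
    intro h hh
    refine (BoundedContinuousFunction.norm_le (by positivity)).2 fun η => ?_
    simp only [BoundedContinuousFunction.coe_sub, Pi.sub_apply, sliceBCF_apply, swapBCF_apply]
    have hconv := convex_closedBall x ‖h‖
    have hx : x ∈ Metric.closedBall x ‖h‖ := Metric.mem_closedBall_self (norm_nonneg h)
    have hxh : x + h ∈ Metric.closedBall x ‖h‖ := by simp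
    have hfirst : ∀ z ∈ Metric.closedBall x ‖h‖,
        ‖TypeOneOne.dFst G (z, η) - TypeOneOne.dFst G (x, η)‖ ≤ M * ‖h‖ := by
      intro z hz
      have hb : ∀ y ∈ Metric.closedBall x ‖h‖,
          ‖TypeOneOne.dFst (TypeOneOne.dFst G) (y, η)‖ ≤ M := by
        intro y hy
        refine (hC y η).trans ?_
        rw [mem_closedBall_iff_norm] at hy
        have := norm_le_norm_add_norm_sub' y x
        rw [hM]
        gcongr
        linarith
      refine (hconv.norm_image_sub_le_of_norm_hasFDerivWithin_le
        (f := fun y => TypeOneOne.dFst G (y, η))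
        (fun y _ => (hasFDerivAt_slice_fst hG.dFst.temperate.1 y η).hasFDerivWithinAt)
        hb hx hz).trans ?_
      gcongr
      exact mem_closedBall_iff_norm.1 hz
    have := hconv.norm_image_sub_le_of_norm_hasFDerivWithin_le' (f := fun y => G (y, η))
      (fun y _ => (hasFDerivAt_slice_fst hG.temperate.1 y η).hasFDerivWithinAt)
      (φ := TypeOneOne.dFst G (x, η)) hfirst hx hxh
    rw [add_sub_cancel_left] at this
    exact this.trans (le_of_eq (by ring))
  rw [hasFDerivAt_iff_isLittleO_nhds_zero]
  refine Asymptotics.IsBigO.trans_isLittleO (g := fun h : Rn n => ‖h‖ ^ 2) ?_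
    (Asymptotics.isLittleO_norm_pow_id one_lt_two)
  refine Asymptotics.IsBigO.of_bound M ?_
  filter_upwards [Metric.closedBall_mem_nhds (0 : Rn n) one_pos] with h hh
  rw [Real.norm_of_nonneg (by positivity)]
  exact key h (by simpa using hh)

theorem fderiv_sliceBCF (hG : FreqSupported R G) :
    fderiv ℝ (sliceBCF hG) = swapBCF ∘ sliceBCF hG.dFst :=
  funext fun x => (hasFDerivAt_sliceBCF hG x).fderiv

/-- The derivative is `swapBCF` composed with the slice map of `dFst G`, which is of the same kind
with a larger target space; hence the induction over all targets. -/
theorem contDiff_sliceBCF_nat (m : ℕ) :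
    ∀ {V : Type} [NormedAddCommGroup V] [NormedSpace ℝ V] {G : Rn n × Rn n → V}
      (hG : FreqSupported R G), ContDiff ℝ m (sliceBCF hG) := by
  induction m with
  | zero =>
    intro V _ _ G hG
    exact contDiff_zero.2 (continuous_iff_continuousAt.2 fun x =>
      (hasFDerivAt_sliceBCF hG x).continuousAt)
  | succ m ih =>
    intro V _ _ G hG
    push_cast
    refine contDiff_succ_iff_fderiv.2
      ⟨fun x => (hasFDerivAt_sliceBCF hG x).differentiableAt, by simp, ?_⟩
    rw [fderiv_sliceBCF]
    exact swapBCF.contDiff.comp (ih hG.dFst)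

theorem exists_norm_iteratedFDeriv_clm_comp_le {X : Type} [NormedAddCommGroup X]
    [NormedSpace ℝ X] (L : V →L[ℝ] W) (m : ℕ) :
    ∃ K : ℝ, 0 ≤ K ∧ ∀ (f : X → V) (x : X), ContDiff ℝ m f →
      ‖iteratedFDeriv ℝ m (L ∘ f) x‖ ≤ K * ‖iteratedFDeriv ℝ m f x‖ :=
  ⟨‖L‖, norm_nonneg L, fun _ _ hf => L.norm_iteratedFDeriv_comp_left hf.contDiffAt le_rfl⟩

theorem exists_iteratedFDeriv_sliceBCF_le (m : ℕ) :
    ∀ {V : Type} [NormedAddCommGroup V] [NormedSpace ℝ V] {G : Rn n × Rn n → V}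
      (hG : FreqSupported R G), ∃ (N : ℕ) (C : ℝ), ∀ x,
        ‖iteratedFDeriv ℝ m (sliceBCF hG) x‖ ≤ C * (1 + ‖x‖) ^ N := by
  induction m with
  | zero =>
    intro V _ _ G hG
    obtain ⟨N, C, C0, hC⟩ := hG.exists_norm_le
    refine ⟨N, C, fun x => ?_⟩
    rw [norm_iteratedFDeriv_zero]
    exact (BoundedContinuousFunction.norm_le (by positivity)).2 fun η => hC x η
  | succ m ih =>
    intro V _ _ G hG
    obtain ⟨N, C, hC⟩ := ih hG.dFst
    obtain ⟨K, K0, hK⟩ := exists_norm_iteratedFDeriv_clm_comp_le (X := Rn n)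
      (V := Rn n →ᵇ (Rn n →L[ℝ] V)) (W := Rn n →L[ℝ] (Rn n →ᵇ V)) swapBCF m
    refine ⟨N, K * C, fun x => ?_⟩
    rw [← norm_iteratedFDeriv_fderiv, fderiv_sliceBCF, mul_assoc]
    exact (hK _ x (contDiff_sliceBCF_nat m hG.dFst)).trans (mul_le_mul_of_nonneg_left (hC x) K0)

theorem hasTemperateGrowth_sliceBCF (hG : FreqSupported R G) :
    (sliceBCF hG).HasTemperateGrowth :=
  ⟨contDiff_infty.2 fun m => contDiff_sliceBCF_nat m hG,
    fun m => exists_iteratedFDeriv_sliceBCF_le m hG⟩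

end SliceMaps

/-- The bound forces ker J ⊆ ker f, so f factors through the range of J. The factor is bounded
there, and Hahn–Banach extends it to E. -/
theorem exists_clm_comp_eq_of_norm_le {X E : Type*} [AddCommGroup X] [Module ℂ X]
    [NormedAddCommGroup E] [NormedSpace ℂ E] (J : X →ₗ[ℂ] E) (f : X →ₗ[ℂ] ℂ) {C : ℝ}
    (h : ∀ x, ‖f x‖ ≤ C * ‖J x‖) : ∃ L : E →L[ℂ] ℂ, ∀ x, L (J x) = f x := by
  have hker : f ∈ J.dualMap.range := by
    rw [LinearMap.range_dualMap_eq_dualAnnihilator_ker, Submodule.mem_dualAnnihilator]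
    intro x hx
    have := h x
    rw [LinearMap.mem_ker.1 hx] at this
    simpa using this
  obtain ⟨g, hg⟩ := hker
  have hg' : ∀ x, g (J x) = f x := fun x => by rw [← hg]; rfl
  let g₀ : StrongDual ℂ J.range := (g.comp J.range.subtype).mkContinuous C (by
    rintro ⟨-, x, rfl⟩
    change ‖g (J x)‖ ≤ C * ‖J x‖
    rw [hg']
    exact h x)
  obtain ⟨L, hL, -⟩ := exists_extension_norm_eq J.range g₀
  refine ⟨L, fun x => ?_⟩
  rw [← hg']
  exact hL ⟨J x, x, rfl⟩

/-- Apply the single-map case to the product of the `E i` with the sup norm, then restrict the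
functional to the coordinates. -/
theorem exists_eq_sum_clm_comp {X ι : Type*} [AddCommGroup X] [Module ℂ X] [Fintype ι]
    {E : ι → Type*} [∀ i, NormedAddCommGroup (E i)] [∀ i, NormedSpace ℂ (E i)]
    (J : ∀ i, X →ₗ[ℂ] E i) (f : X →ₗ[ℂ] ℂ) {C : ℝ}
    (h : ∀ x B, 0 ≤ B → (∀ i, ‖J i x‖ ≤ B) → ‖f x‖ ≤ C * B) :
    ∃ L : ∀ i, E i →L[ℂ] ℂ, ∀ x, f x = ∑ i, L i (J i x) := by
  classical
  obtain ⟨L, hL⟩ := exists_clm_comp_eq_of_norm_le (LinearMap.pi J) f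
    (fun x => h x _ (norm_nonneg _) fun i => norm_le_pi_norm (LinearMap.pi J x) i)
  refine ⟨fun i => L.comp (ContinuousLinearMap.single ℂ E i), fun x => ?_⟩
  rw [← hL x, ← Finset.univ_sum_single (LinearMap.pi J x), map_sum]
  rfl

/-! ### Structure of tempered distributions and the range in O_M. -/

section Jets

variable {n : ℕ}

/-- The map `ψ ↦ (1 + ‖·‖²)ᵏ D^l ψ` from Schwartz functions to bounded continuous functions. -/
def jet (k l : ℕ) : 𝓢(Rn n, ℂ) →ₗ[ℂ] (Rn n →ᵇ (Rn n [×l]→L[ℝ] ℂ)) where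
  toFun ψ := BoundedContinuousFunction.ofNormedAddCommGroup
    (fun η => ((1 + ‖η‖ ^ 2) ^ k : ℝ) • iteratedFDeriv ℝ l ψ η)
    (by
      have h : Continuous (iteratedFDeriv ℝ l ψ) :=
        (ψ.smooth ⊤).continuous_iteratedFDeriv (mod_cast le_top)
      fun_prop)
    (2 ^ (2 * k) * (Finset.Iic (2 * k, l)).sup (fun m => SchwartzMap.seminorm ℝ m.1 m.2) ψ)
    (fun η => by
      rw [norm_smul, Real.norm_of_nonneg (by positivity)]
      refine le_trans ?_ (SchwartzMap.one_add_le_sup_seminorm_apply (𝕜 := ℝ) (m := (2 * k, l))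
        le_rfl le_rfl ψ η)
      rw [pow_mul]
      gcongr
      nlinarith [norm_nonneg η])
  map_add' ψ ψ' := by
    ext1 η
    change ((1 + ‖η‖ ^ 2) ^ k : ℝ) • iteratedFDeriv ℝ l (ψ + ψ' : Rn n → ℂ) η =
      ((1 + ‖η‖ ^ 2) ^ k : ℝ) • iteratedFDeriv ℝ l ψ η +
      ((1 + ‖η‖ ^ 2) ^ k : ℝ) • iteratedFDeriv ℝ l ψ' η
    rw [iteratedFDeriv_add_apply ((ψ.smooth l).contDiffAt) ((ψ'.smooth l).contDiffAt), smul_add]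
  map_smul' c ψ := by
    ext1 η
    change ((1 + ‖η‖ ^ 2) ^ k : ℝ) • iteratedFDeriv ℝ l (c • (ψ : Rn n → ℂ)) η =
      c • (((1 + ‖η‖ ^ 2) ^ k : ℝ) • iteratedFDeriv ℝ l ψ η)
    rw [iteratedFDeriv_const_smul_apply ((ψ.smooth l).contDiffAt), smul_comm]

theorem jet_apply (k l : ℕ) (ψ : 𝓢(Rn n, ℂ)) (η : Rn n) :
    jet k l ψ η = ((1 + ‖η‖ ^ 2) ^ k : ℝ) • iteratedFDeriv ℝ l ψ η := rfl

/-- Since |η| ≤ 1 + |η|², the weight in `jet` dominates |η|^k; unlike |η|^k it is smooth for every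
k. -/
theorem seminorm_le_norm_jet (k l : ℕ) (ψ : 𝓢(Rn n, ℂ)) :
    SchwartzMap.seminorm ℂ k l ψ ≤ ‖jet k l ψ‖ := by
  refine SchwartzMap.seminorm_le_bound ℂ k l ψ
    ((norm_nonneg (jet k l ψ 0)).trans ((jet k l ψ).norm_coe_le_norm 0)) fun η => ?_
  refine le_trans ?_ ((jet k l ψ).norm_coe_le_norm η)
  rw [jet_apply, norm_smul, Real.norm_of_nonneg (by positivity)]
  gcongr
  nlinarith [sq_nonneg (‖η‖ - 1), norm_nonneg η]

theorem exists_eq_sum_jet (u : 𝓢'(Rn n, ℂ)) :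
    ∃ (s : Finset (ℕ × ℕ)) (L : ∀ i : s, (Rn n →ᵇ (Rn n [×i.1.2]→L[ℝ] ℂ)) →L[ℂ] ℂ),
      ∀ ψ : 𝓢(Rn n, ℂ), u ψ = ∑ i : s, L i (jet i.1.1 i.1.2 ψ) := by
  let f : 𝓢(Rn n, ℂ) →ₗ[ℂ] ℂ := PointwiseConvergenceCLM.coeLM ℂ 𝓢(Rn n, ℂ) ℂ u
  have hf : Continuous f := map_continuous u
  obtain ⟨s, C, -, hC⟩ := Seminorm.bound_of_continuous (schwartz_withSeminorms ℂ (Rn n) ℂ)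
    ((normSeminorm ℂ ℂ).comp f) hf.norm
  obtain ⟨L, hL⟩ := exists_eq_sum_clm_comp
    (E := fun i : s => (Rn n →ᵇ (Rn n [×i.1.2]→L[ℝ] ℂ))) (fun i => jet i.1.1 i.1.2) f (C := C)
    (fun ψ B B0 hB => by
      refine (hC ψ).trans ?_
      change (C : ℝ) * _ ≤ _
      refine mul_le_mul_of_nonneg_left ?_ C.2
      exact Seminorm.finset_sup_apply_le B0 fun i hi =>
        (seminorm_le_norm_jet i.1 i.2 ψ).trans (hB ⟨i, hi⟩))
  exact ⟨s, L, hL⟩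

variable {R : ℝ} {F : Rn n × Rn n → ℂ}

theorem FreqSupported.iteratedFDeriv_snd (hF : FreqSupported R F) (l : ℕ) :
    FreqSupported R (fun p : Rn n × Rn n => iteratedFDeriv ℝ l (fun η => F (p.1, η)) p.2) := by
  induction l with
  | zero =>
    let e := (continuousMultilinearCurryFin0 ℝ (Rn n) ℂ).symm
    exact hF.clm_comp e.toContinuousLinearEquiv.toContinuousLinearMap
  | succ l ih =>
    let e := (continuousMultilinearCurryLeftEquiv ℝ (fun _ : Fin (l + 1) => Rn n) ℂ).symm
    have h := ih.dSnd.clm_comp (W := Rn n [×(l + 1)]→L[ℝ] ℂ)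
      e.toContinuousLinearEquiv.toContinuousLinearMap
    convert h using 1
    ext1 p
    rw [← (hasFDerivAt_slice_snd ih.temperate.1 p.1 p.2).fderiv]
    rfl

theorem FreqSupported.jet (hF : FreqSupported R F) (k l : ℕ) :
    FreqSupported R (fun p : Rn n × Rn n =>
      ((1 + ‖p.2‖ ^ 2) ^ k : ℝ) • iteratedFDeriv ℝ l (fun η => F (p.1, η)) p.2) := by
  have h := hF.iteratedFDeriv_snd l
  refine ⟨?_, fun x η hη => ?_⟩
  · have hw : (fun η : Rn n => ((1 + ‖η‖ ^ 2) ^ k : ℝ)).HasTemperateGrowth :=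
      ((Function.HasTemperateGrowth.const _).add (Function.hasTemperateGrowth_norm_sq (Rn n))).pow k
    exact (hw.comp (ContinuousLinearMap.snd ℝ (Rn n) (Rn n)).hasTemperateGrowth).smul h.temperate
  · have := h.eq_zero x η hη
    dsimp only at this ⊢
    rw [this, smul_zero]

/-- The slice `F(x, ·)` as a Schwartz function. -/
def sliceSchwartz (hF : FreqSupported R F) (x : Rn n) : 𝓢(Rn n, ℂ) :=
  HasCompactSupport.toSchwartzMap (f := fun η => F (x, η))
    (HasCompactSupport.intro (isCompact_closedBall 0 R) fun η hη =>
      hF.eq_zero x η (by simpa using hη))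
    (hF.temperate.1.comp (contDiff_prodMk_right x))

theorem jet_sliceSchwartz (hF : FreqSupported R F) (x : Rn n) (k l : ℕ) :
    jet k l (sliceSchwartz hF x) = sliceBCF (hF.jet k l) x := by
  ext1 η
  rfl

theorem integrable_smul_sliceBCF {V : Type} [NormedAddCommGroup V] [NormedSpace ℝ V]
    [NormedSpace ℂ V] {G : Rn n × Rn n → V} (hG : FreqSupported R G) (φ : 𝓢(Rn n, ℂ)) :
    Integrable (fun x => φ x • sliceBCF hG x) := by
  obtain ⟨N, C, hC⟩ := (hasTemperateGrowth_sliceBCF hG).2 0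
  obtain ⟨s, D, D0, hD⟩ := exists_integral_one_add_norm_pow_le (n := n) N
  refine ((hD φ).1.const_mul C).mono' (Continuous.aestronglyMeasurable ?_)
    (ae_of_all _ fun x => ?_)
  · exact φ.continuous.smul (hasTemperateGrowth_sliceBCF hG).1.continuous
  · rw [norm_smul]
    have := hC x
    rw [norm_iteratedFDeriv_zero] at this
    calc _ ≤ ‖φ x‖ * (C * (1 + ‖x‖) ^ N) := by gcongr
      _ = _ := by ring

/-- Differentiation under the integral, read as a Bochner integral of bounded functions; equality is
checked by evaluating at each η. -/
theorem jet_transposeCLM (hF : FreqSupported R F) (φ : 𝓢(Rn n, ℂ)) (k l : ℕ) :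
    jet k l (transposeCLM hF φ) = ∫ x, φ x • sliceBCF (hF.jet k l) x := by
  ext1 η
  have h1 : (∫ x, φ x • sliceBCF (hF.jet k l) x) η = ∫ x, (φ x • sliceBCF (hF.jet k l) x) η :=
    ((BoundedContinuousFunction.evalCLM ℝ η).integral_comp_comm
      (integrable_smul_sliceBCF (hF.jet k l) φ)).symm
  rw [h1, jet_apply]
  obtain ⟨Hm, -, h2, h3⟩ := (hF.decaySnd_swap φ).exists_iteratedFDeriv_integral l
  have h4 : iteratedFDeriv ℝ l (transposeCLM hF φ) η = ∫ x, Hm (η, x) := h3 η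
  rw [h4, ← integral_smul]
  refine integral_congr_ae (ae_of_all _ fun x => ?_)
  dsimp only
  have hs : ContDiff ℝ ∞ (fun q => F (x, q)) := hF.temperate.1.comp (contDiff_prodMk_right x)
  rw [h2]
  change _ = φ x • (((1 + ‖η‖ ^ 2) ^ k : ℝ) • iteratedFDeriv ℝ l (fun q => F (x, q)) η)
  have e : (fun q => φ x * F (x, q)) = fun q => φ x • F (x, q) := rfl
  dsimp only
  rw [e, iteratedFDeriv_const_smul_apply' (hs.contDiffAt.of_le (mod_cast le_top)), smul_comm]

theorem hasTemperateGrowth_apply_sliceSchwartz (hF : FreqSupported R F) (u : 𝓢'(Rn n, ℂ)) :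
    (fun x => u (sliceSchwartz hF x)).HasTemperateGrowth := by
  obtain ⟨s, L, hL⟩ := exists_eq_sum_jet u
  simp_rw [hL, jet_sliceSchwartz]
  refine Function.HasTemperateGrowth.sum fun i _ => ?_
  exact ((L i).restrictScalars ℝ).hasTemperateGrowth.comp (hasTemperateGrowth_sliceBCF _)

/-- Moves a distribution inside the integral. Through `exists_eq_sum_jet` this reduces to bounded
functionals on Banach spaces, which commute with Bochner integrals. -/
theorem apply_transposeCLM (hF : FreqSupported R F) (u : 𝓢'(Rn n, ℂ)) (φ : 𝓢(Rn n, ℂ)) :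
    u (transposeCLM hF φ) = ∫ x, φ x * u (sliceSchwartz hF x) := by
  obtain ⟨s, L, hL⟩ := exists_eq_sum_jet u
  simp_rw [hL, jet_sliceSchwartz, jet_transposeCLM, Finset.mul_sum]
  have h : ∀ i : s, Integrable (fun x => φ x * L i (sliceBCF (hF.jet i.1.1 i.1.2) x)) := by
    intro i
    have := (L i).integrable_comp (integrable_smul_sliceBCF (hF.jet i.1.1 i.1.2) φ)
    simpa using this
  rw [integral_finsetSum _ fun i _ => h i]
  refine Finset.sum_congr rfl fun i _ => ?_
  rw [← (L i).integral_comp_comm (integrable_smul_sliceBCF (hF.jet i.1.1 i.1.2) φ)]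
  simp

theorem inOM_extOp (hF : FreqSupported R F) (u : 𝓢'(Rn n, ℂ)) : InOM (extOp hF u) := by
  refine ⟨_, hasTemperateGrowth_apply_sliceSchwartz hF (𝓕 u), ?_⟩
  ext φ
  rw [extOp_apply, apply_transposeCLM]
  rfl

end Jets

open Distribution
open scoped Manifold

/-! ### Uniqueness of continuous extensions to 𝓢'. -/

section Uniqueness

variable {n : ℕ}

/-- Passes through L², whose embedding into tempered distributions has trivial kernel. -/
theorem toDistr_injective : Function.Injective (toDistr (n := n)) := by
  rw [injective_iff_map_eq_zero (SchwartzMap.toTemperedDistributionCLM (Rn n) ℂ volume)]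
  intro v hv
  have : Fact ((1 : ENNReal) ≤ 2) := ⟨one_le_two⟩
  have h1 : v.toLp 2 volume ∈ (Lp.toTemperedDistributionCLM ℂ (volume : Measure (Rn n)) 2).ker :=
    (Lp.toTemperedDistribution_toLp_eq (μ := volume) v).trans hv
  rw [Lp.ker_toTemperedDistributionCLM_eq_bot, Submodule.mem_bot] at h1
  refine SchwartzMap.injective_toLp 2 (volume : Measure (Rn n)) ?_
  change v.toLp 2 volume = (0 : 𝓢(Rn n, ℂ)).toLp 2 volume
  rw [h1]
  exact (map_zero (SchwartzMap.toLpCLM ℂ ℂ 2 (volume : Measure (Rn n)))).symm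

/-- Pointwise convergence is the weak-* topology, and its continuous functionals are the
evaluations. -/
theorem exists_eq_apply (l : 𝓢'(Rn n, ℂ) →L[ℂ] ℂ) : ∃ ψ : 𝓢(Rn n, ℂ), ∀ u, l u = u ψ := by
  let e := PointwiseConvergenceCLM.equivWeakDual ℂ 𝓢(Rn n, ℂ)
  obtain ⟨ψ, hψ⟩ := LinearMap.dualEmbedding_surjective (topDualPairing ℂ 𝓢(Rn n, ℂ))
    (l.comp (e.symm : WeakDual ℂ 𝓢(Rn n, ℂ) →L[ℂ] 𝓢'(Rn n, ℂ)))
  exact ⟨ψ, fun u => (DFunLike.congr_fun hψ (e u)).symm⟩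

theorem clm_eq_of_toDistr_eq {S T : 𝓢'(Rn n, ℂ) →L[ℂ] 𝓢'(Rn n, ℂ)}
    (h : ∀ v : 𝓢(Rn n, ℂ), S (toDistr v) = T (toDistr v)) : S = T := by
  ext u φ
  obtain ⟨ψ, hψ⟩ := exists_eq_apply
    ((PointwiseConvergenceCLM.evalCLM (RingHom.id ℂ) ℂ φ).comp (S - T))
  have hψ' : ∀ u, S u φ - T u φ = u ψ := hψ
  -- The functional u ↦ ⟨(S - T)u, φ⟩ is evaluation at ψ and kills every Schwartz function v. As ∫ψv
  -- is symmetric, ψ defines the zero distribution.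
  have hz : ψ = 0 := by
    apply toDistr_injective
    ext v
    have h1 : toDistr v ψ = 0 := by rw [← hψ', h, sub_self]
    rw [toDistr_apply] at h1
    have h2 : toDistr ψ v = 0 := by
      rw [toDistr_apply]
      simpa only [mul_comm] using h1
    rw [h2, toDistr_apply]
    simp
  have := hψ' u
  rw [hz, map_zero] at this
  exact sub_eq_zero.1 this

theorem IsContinuousExtension.unique {a : Rn n → Rn n → ℂ}
    {S T : 𝓢'(Rn n, ℂ) →L[ℂ] 𝓢'(Rn n, ℂ)} (hS : IsContinuousExtension a S)
    (hT : IsContinuousExtension a T) : S = T := by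
  refine clm_eq_of_toDistr_eq fun v => ?_
  obtain ⟨w, hw, hw'⟩ := hS v
  obtain ⟨z, hz, hz'⟩ := hT v
  rw [hw', hz', show w = z from SchwartzMap.ext fun x => (hw x).trans (hz x).symm]

end Uniqueness

/-! ### A distribution vanishes off its support. -/

section Support

variable {n : ℕ}

theorem exists_contDiff_eq_one_nhdsSet {K : Set (Rn n)} (hK : IsCompact K) :
    ∃ χ : Rn n → ℂ, ContDiff ℝ ∞ χ ∧ HasCompactSupport χ ∧ ∀ᶠ ξ in 𝓝ˢ K, χ ξ = 1 := by
  obtain ⟨K', hK', hKK'⟩ := exists_compact_superset hK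
  obtain ⟨f, hf1, hf0, -⟩ := exists_contMDiffMap_one_nhds_of_subset_interior (n := ⊤)
    (𝓘(ℝ, Rn n)) hK.isClosed hKK'
  refine ⟨fun x => (f x : ℂ), Complex.ofRealCLM.contDiff.comp f.contMDiff.contDiff,
    HasCompactSupport.intro hK' fun x hx => by simp [hf0 x hx], ?_⟩
  filter_upwards [hf1] with x hx
  simp [hx]

/-- Finitely many open sets on which f vanishes cover the support of φ; a subordinate partition of
unity splits φ into pieces, each supported in one of them. -/
theorem apply_eq_zero_of_hasCompactSupport (f : 𝓢'(Rn n, ℂ)) {φ : 𝓢(Rn n, ℂ)}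
    (hc : HasCompactSupport φ) (h : tsupport φ ⊆ (dsupport f)ᶜ) : f φ = 0 := by
  have hx : ∀ x : ((dsupport f)ᶜ : Set (Rn n)), ∃ s : Set (Rn n), IsVanishingOn f s ∧ IsOpen s ∧ x.1 ∈ s :=
    fun x => (notMem_dsupport_iff x.1).1 x.2
  choose U hU hUo hxU using hx
  obtain ⟨t, ht⟩ := hc.isCompact.elim_finite_subcover U hUo
    fun x hx => Set.mem_iUnion.2 ⟨⟨x, h hx⟩, hxU ⟨x, h hx⟩⟩
  obtain ⟨p, hp⟩ := SmoothPartitionOfUnity.exists_isSubordinate (𝓘(ℝ, Rn n))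
    (isClosed_tsupport φ) (fun i : t => U i.1) (fun i => hUo i.1)
    (fun x hx => by
      obtain ⟨i, hi, hxi⟩ := Set.mem_iUnion₂.1 (ht hx)
      exact Set.mem_iUnion.2 ⟨⟨i, hi⟩, hxi⟩)
  have hsm : ∀ i : t, ContDiff ℝ ∞ (fun x => (p i x : ℂ) * φ x) := fun i =>
    (Complex.ofRealCLM.contDiff.comp (p i).contMDiff.contDiff).mul (φ.smooth ⊤)
  let q : t → 𝓢(Rn n, ℂ) := fun i => (hc.mul_left (f := fun x => (p i x : ℂ))).toSchwartzMap (hsm i)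
  have hsum : φ = ∑ i, q i := by
    ext x
    rw [sum_apply]
    change φ x = ∑ i, (p i x : ℂ) * φ x
    rw [← Finset.sum_mul]
    by_cases hx : x ∈ tsupport φ
    · have h1 := p.sum_eq_one hx
      rw [finsum_eq_sum_of_fintype] at h1
      rw [← Complex.ofReal_sum, h1, Complex.ofReal_one, one_mul]
    · rw [image_eq_zero_of_notMem_tsupport hx, mul_zero]
  rw [hsum, map_sum]
  refine Finset.sum_eq_zero fun i _ => hU i.1 (q i) (Set.Subset.trans ?_ (hp i))
  refine closure_mono fun x hx hx' => hx ?_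
  change (p i x : ℂ) * φ x = 0
  rw [hx', Complex.ofReal_zero, zero_mul]

/-- Where t|x| ≤ 1 the derivative is zero, and elsewhere t|x| ≥ 1 may be inserted as a factor. The
chain rule contributes powers of t, which are at most 1. -/
theorem norm_iteratedFDeriv_comp_smul_le {g : Rn n → ℂ} (hg : ContDiff ℝ ∞ g)
    (hg0 : ∀ x, ‖x‖ ≤ 1 → g =ᶠ[𝓝 x] 0) {i : ℕ} {B : ℝ}
    (hB : ∀ x, ‖iteratedFDeriv ℝ i g x‖ ≤ B) {t : ℝ} (ht : 0 ≤ t) (ht1 : t ≤ 1) (x : Rn n) :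
    ‖iteratedFDeriv ℝ i (fun y => g (t • y)) x‖ ≤ B * (t * ‖x‖) := by
  have hB0 : 0 ≤ B := (norm_nonneg _).trans (hB 0)
  let L : Rn n →L[ℝ] Rn n := t • ContinuousLinearMap.id ℝ (Rn n)
  have hL : ‖L‖ ≤ 1 := by
    refine ContinuousLinearMap.opNorm_le_bound _ zero_le_one fun y => ?_
    change ‖t • y‖ ≤ _
    rw [norm_smul, Real.norm_of_nonneg ht]
    gcongr
  have h1 : iteratedFDeriv ℝ i (fun y => g (t • y)) x =
      (iteratedFDeriv ℝ i g (t • x)).compContinuousLinearMap fun _ => L :=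
    L.iteratedFDeriv_comp_right hg x (mod_cast le_top)
  have h2 : ‖iteratedFDeriv ℝ i (fun y => g (t • y)) x‖ ≤ ‖iteratedFDeriv ℝ i g (t • x)‖ := by
    rw [h1]
    refine (ContinuousMultilinearMap.norm_compContinuousLinearMap_le _ _).trans ?_
    refine mul_le_of_le_one_right (norm_nonneg _) ?_
    exact Finset.prod_le_one (fun _ _ => norm_nonneg _) fun _ _ => hL
  refine h2.trans ?_
  have h3 : ‖t • x‖ = t * ‖x‖ := by rw [norm_smul, Real.norm_of_nonneg ht]
  rcases le_total ‖t • x‖ 1 with h | h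
  · rw [((hg0 _ h).iteratedFDeriv ℝ i).self_of_nhds]
    simp only [Pi.zero_def, iteratedFDeriv_fun_zero, Pi.zero_apply, norm_zero]
    positivity
  · rw [← h3]
    exact (hB _).trans (le_mul_of_one_le_right hB0 h)

theorem tendsto_smulLeftCLM_dilate {θ : Rn n → ℂ} (hθ : ContDiff ℝ ∞ θ)
    (hc : HasCompactSupport θ) (h1 : ∀ᶠ x in 𝓝ˢ (Metric.closedBall 0 1), θ x = 1)
    (hT : ∀ t : ℝ, (fun x => θ (t • x)).HasTemperateGrowth) (φ : 𝓢(Rn n, ℂ)) :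
    Filter.Tendsto (fun j : ℕ => SchwartzMap.smulLeftCLM ℂ (fun x => θ ((1 / ((j : ℝ) + 1)) • x)) φ)
      Filter.atTop (𝓝 φ) := by
  have hg : ContDiff ℝ ∞ (fun x => 1 - θ x) := contDiff_const.sub hθ
  have hg0 : ∀ x : Rn n, ‖x‖ ≤ 1 → (fun x => 1 - θ x) =ᶠ[𝓝 x] 0 := fun x hx => by
    filter_upwards [Filter.Eventually.filter_mono (nhds_le_nhdsSet (by simpa using hx)) h1]
      with y hy
    simp [hy]
  have hB : ∀ i : ℕ, ∃ B, ∀ x, ‖iteratedFDeriv ℝ i (fun x => 1 - θ x) x‖ ≤ B := by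
    intro i
    obtain ⟨B, hB⟩ := (hc.iteratedFDeriv (𝕜 := ℝ) i).exists_bound_of_continuous
      (hθ.continuous_iteratedFDeriv (mod_cast le_top))
    refine ⟨1 + B, fun x => ?_⟩
    have : iteratedFDeriv ℝ i (fun x => 1 - θ x) x =
        iteratedFDeriv ℝ i (fun _ => (1 : ℂ)) x - iteratedFDeriv ℝ i θ x :=
      iteratedFDeriv_sub_apply contDiff_const.contDiffAt
        (hθ.contDiffAt.of_le (mod_cast le_top))
    rw [this]
    refine (norm_sub_le _ _).trans (add_le_add ?_ (hB x))
    rcases i with - | i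
    · simp
    · rw [iteratedFDeriv_succ_const]
      simp
  choose B hB using hB
  rw [(schwartz_withSeminorms ℝ (Rn n) ℂ).tendsto_nhds _ _]
  rintro ⟨k, l⟩ ε hε
  -- Each derivative of 1 - θ(t·) gains t|x|. The factor |x| raises the weight to k + 1, and t gives
  -- the rate of convergence.
  obtain ⟨C, hC⟩ : ∃ C : ℝ, ∀ t : ℝ, 0 ≤ t → t ≤ 1 →
      SchwartzMap.seminorm ℝ k l (SchwartzMap.smulLeftCLM ℂ (fun x => θ (t • x)) φ - φ) ≤ C * t := by
    have hB0 : ∀ i, 0 ≤ B i := fun i => (norm_nonneg _).trans (hB i 0)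
    refine ⟨∑ i ∈ Finset.range (l + 1), (l.choose i : ℝ) * B i *
      SchwartzMap.seminorm ℝ (k + 1) (l - i) φ, fun t t0 t1 => ?_⟩
    refine SchwartzMap.seminorm_le_bound ℝ k l _ (by
      refine mul_nonneg (Finset.sum_nonneg fun i _ => ?_) t0
      have := hB0 i
      positivity) fun x => ?_
    have e : ((SchwartzMap.smulLeftCLM ℂ (fun x => θ (t • x)) φ - φ : 𝓢(Rn n, ℂ)) : Rn n → ℂ) =
        -(fun y => (fun y => (1 - θ (t • y))) y * φ y) := by
      ext y
      rw [sub_apply, SchwartzMap.smulLeftCLM_apply_apply (hT t)]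
      simp only [Pi.neg_apply, smul_eq_mul]
      ring
    rw [e, iteratedFDeriv_neg_apply, norm_neg]
    have hm := norm_iteratedFDeriv_mul_le (N := ∞) (f := fun y : Rn n => 1 - θ (t • y)) (g := φ)
      (hg.comp (contDiff_const_smul t)) (φ.smooth ⊤) x (n := l) (mod_cast le_top)
    calc _ ≤ ‖x‖ ^ k * ∑ i ∈ Finset.range (l + 1), (l.choose i : ℝ) *
            ‖iteratedFDeriv ℝ i (fun y => 1 - θ (t • y)) x‖ * ‖iteratedFDeriv ℝ (l - i) φ x‖ := by
          gcongr
      _ ≤ _ := by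
        rw [Finset.mul_sum, Finset.sum_mul]
        refine Finset.sum_le_sum fun i _ => ?_
        have hi := norm_iteratedFDeriv_comp_smul_le hg hg0 (hB i) t0 t1 x
        have hs := SchwartzMap.le_seminorm ℝ (k + 1) (l - i) φ x
        have := hB0 i
        calc _ ≤ ‖x‖ ^ k * ((l.choose i : ℝ) * (B i * (t * ‖x‖)) *
              ‖iteratedFDeriv ℝ (l - i) φ x‖) := by gcongr
          _ = (l.choose i : ℝ) * B i * t * (‖x‖ ^ (k + 1) * ‖iteratedFDeriv ℝ (l - i) φ x‖) := by
            ring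
          _ ≤ (l.choose i : ℝ) * B i * t * SchwartzMap.seminorm ℝ (k + 1) (l - i) φ := by gcongr
          _ = _ := by ring
  have hlim : Filter.Tendsto (fun j : ℕ => C * (1 / ((j : ℝ) + 1))) Filter.atTop (𝓝 0) := by
    simpa using tendsto_one_div_add_atTop_nhds_zero_nat.const_mul C
  filter_upwards [hlim.eventually_lt_const hε] with j hj
  refine lt_of_le_of_lt (hC _ (by positivity) ?_) hj
  rw [div_le_one (by positivity)]
  linarith [(Nat.cast_nonneg j : (0 : ℝ) ≤ j)]

/-- For a test function without compact support, truncate by dilated cut-offs: the truncations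
converge in 𝓢 and keep their supports inside that of φ. -/
theorem isVanishingOn_compl_dsupport (f : 𝓢'(Rn n, ℂ)) : IsVanishingOn f (dsupport f)ᶜ := by
  intro φ hφ
  obtain ⟨θ, hθ, hc, h1⟩ := exists_contDiff_eq_one_nhdsSet
    (isCompact_closedBall (0 : Rn n) 1)
  have hT : ∀ t : ℝ, (fun x => θ (t • x)).HasTemperateGrowth := fun t =>
    (hc.hasTemperateGrowth hθ).comp (t • ContinuousLinearMap.id ℝ (Rn n)).hasTemperateGrowth
  have hlim := ((map_continuous f).tendsto φ).comp (tendsto_smulLeftCLM_dilate hθ hc h1 hT φ)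
  refine tendsto_nhds_unique hlim (tendsto_const_nhds.congr fun j => Eq.symm ?_)
  have hts := SchwartzMap.tsupport_smulLeftCLM_subset
    (fun x : Rn n => θ ((1 / ((j : ℝ) + 1)) • x)) φ
  refine apply_eq_zero_of_hasCompactSupport f ?_ ((hts.trans Set.inter_subset_left).trans hφ)
  have hcj : HasCompactSupport (fun x : Rn n => θ ((1 / ((j : ℝ) + 1)) • x)) :=
    hc.comp_smul (by positivity)
  exact hcj.of_isClosed_subset (isClosed_tsupport _) (hts.trans Set.inter_subset_right)

theorem apply_eq_of_eqOn_nhdsSet_dsupport (f : 𝓢'(Rn n, ℂ)) {φ ψ : 𝓢(Rn n, ℂ)}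
    (h : ∀ᶠ x in 𝓝ˢ (dsupport f), φ x = ψ x) : f φ = f ψ := by
  rw [← sub_eq_zero, ← map_sub]
  refine isVanishingOn_compl_dsupport f _ fun x hx hxs => ?_
  refine notMem_tsupport_iff_eventuallyEq.2 ?_ hx
  filter_upwards [h.filter_mono (nhds_le_nhdsSet hxs)] with y hy
  rw [sub_apply, hy, sub_self, Pi.zero_apply]

end Support

/-! ### Truncated symbols and independence of the cut-off. -/

variable {n : ℕ} {a : Rn n → Rn n → ℂ} {χ : Rn n → ℂ}

theorem SlowGrowth.cutSymbol (ha : SlowGrowth (fun p : Rn n × Rn n => a p.1 p.2))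
    (hχ : χ.HasTemperateGrowth) :
    SlowGrowth (fun p : Rn n × Rn n => cutSymbol a χ p.1 p.2) :=
  SlowGrowth.bilinear (ContinuousLinearMap.mul ℝ ℂ) ha (SlowGrowth.comp_snd hχ)

theorem exists_freqSupported_cutSymbol (ha : SlowGrowth (fun p : Rn n × Rn n => a p.1 p.2))
    (hχ : ContDiff ℝ ∞ χ) (hc : HasCompactSupport χ) :
    ∃ R, FreqSupported R (fun p => phase p * rescale (cutSymbol a χ) p) := by
  obtain ⟨R, hR⟩ := hc.isCompact.isBounded.exists_norm_le
  refine ⟨R, ⟨hasTemperateGrowth_phase.mul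
    (ha.cutSymbol (hc.hasTemperateGrowth hχ)).rescale.hasTemperateGrowth, fun x η hη => ?_⟩⟩
  -- The radius R for χ in ξ also works in η, since |2πη| ≥ |η|.
  have h : χ ((2 * Real.pi) • η) = 0 := by
    refine image_eq_zero_of_notMem_tsupport fun hm => (hR _ hm).not_gt (hη.trans_le ?_)
    rw [norm_smul, Real.norm_of_nonneg (by positivity)]
    exact le_mul_of_one_le_left (norm_nonneg η) (by linarith [Real.two_le_pi])
  simp only [rescale, TypeOneOne.cutSymbol, h, mul_zero]

/-- The operator with symbol `a(x, ξ) χ(ξ)` extends to tempered distributions with values in `O_M`,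
and the dependence of its transpose on `χ` is explicit. -/
theorem exists_isContinuousExtension_cutSymbol
    (ha : SlowGrowth (fun p : Rn n × Rn n => a p.1 p.2))
    (hχ : ContDiff ℝ ∞ χ) (hc : HasCompactSupport χ) :
    ∃ (T : 𝓢'(Rn n, ℂ) →L[ℂ] 𝓢'(Rn n, ℂ)) (P : 𝓢(Rn n, ℂ) → 𝓢(Rn n, ℂ)),
      IsContinuousExtension (cutSymbol a χ) T ∧ (∀ u, InOM (T u)) ∧
      (∀ u φ, T u φ = (𝓕 u : 𝓢'(Rn n, ℂ)) (P φ)) ∧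
      ∀ φ η, P φ η = χ ((2 * Real.pi) • η) * ∫ x, φ x * (phase (x, η) * rescale a (x, η)) := by
  obtain ⟨R, hF⟩ := exists_freqSupported_cutSymbol ha hχ hc
  have hG := (ha.cutSymbol (hc.hasTemperateGrowth hχ)).rescale
  refine ⟨extOp hF, transposeCLM hF, fun v => ⟨oscIntSchwartz (𝓕 v) hG,
    fun x => (op_eq_oscInt _ v x).symm, extOp_toDistr hG hF v⟩, inOM_extOp hF,
    extOp_apply hF, fun φ η => ?_⟩
  rw [transposeCLM_apply, ← integral_const_mul]
  refine integral_congr_ae (ae_of_all _ fun x => ?_)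
  simp only [rescale, cutSymbol]
  ring

theorem IsSpectralCutoff.eventually_nhdsSet_dsupport {u : 𝓢'(Rn n, ℂ)}
    (h : IsSpectralCutoff χ u) :
    ∀ᶠ η in 𝓝ˢ (dsupport (𝓕 u : 𝓢'(Rn n, ℂ))), χ ((2 * Real.pi) • η) = 1 :=
  ((continuous_const_smul (2 * Real.pi)).tendsto_nhdsSet
    fun _ hη => Set.smul_mem_smul_set hη).eventually h.2.2

theorem exists_isSpectralCutoff {K : Set (Rn n)} (hK : IsCompact K) :
    ∃ χ : Rn n → ℂ, ∀ u : 𝓢'(Rn n, ℂ), spec u ⊆ K → IsSpectralCutoff χ u := by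
  obtain ⟨χ, h1, h2, h3⟩ := exists_contDiff_eq_one_nhdsSet hK
  exact ⟨χ, fun u hu => ⟨h1, h2, h3.filter_mono (nhdsSet_mono hu)⟩⟩

theorem hasTemperateGrowth_comp_two_pi_smul (hχ : ContDiff ℝ ∞ χ) (hc : HasCompactSupport χ) :
    (fun η => χ ((2 * Real.pi) • η)).HasTemperateGrowth :=
  (hc.hasTemperateGrowth hχ).comp
    ((2 * Real.pi) • ContinuousLinearMap.id ℝ (Rn n)).hasTemperateGrowth

theorem IsSpectralCutoff.fourier_apply_smulLeftCLM {u : 𝓢'(Rn n, ℂ)} (h : IsSpectralCutoff χ u)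
    (φ : 𝓢(Rn n, ℂ)) :
    (𝓕 u : 𝓢'(Rn n, ℂ)) (SchwartzMap.smulLeftCLM ℂ (fun η => χ ((2 * Real.pi) • η)) φ) =
      (𝓕 u : 𝓢'(Rn n, ℂ)) φ := by
  refine apply_eq_of_eqOn_nhdsSet_dsupport _ ?_
  filter_upwards [h.eventually_nhdsSet_dsupport] with η hη
  rw [SchwartzMap.smulLeftCLM_apply_apply (hasTemperateGrowth_comp_two_pi_smul h.1 h.2.1), hη,
    one_smul]

theorem IsSpectralCutoff.fourierMultiplierCLM_eq_self {u : 𝓢'(Rn n, ℂ)}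
    (h : IsSpectralCutoff χ u) :
    TemperedDistribution.fourierMultiplierCLM ℂ (fun η => χ ((2 * Real.pi) • η)) u = u := by
  have h1 : TemperedDistribution.smulLeftCLM ℂ (fun η => χ ((2 * Real.pi) • η))
      (𝓕 u : 𝓢'(Rn n, ℂ)) = 𝓕 u := by
    ext φ
    exact h.fourier_apply_smulLeftCLM φ
  rw [TemperedDistribution.fourierMultiplierCLM_apply, h1, FourierTransform.fourierInv_fourier_eq]

/-- As χ depends on ξ alone, it can be moved from the symbol onto the Fourier transform of v. -/
theorem op_cutSymbol_eq_op_fourierMultiplierCLM (hχ : ContDiff ℝ ∞ χ) (hc : HasCompactSupport χ)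
    (v : 𝓢(Rn n, ℂ)) (x : Rn n) :
    op (cutSymbol a χ) v x =
      op a (SchwartzMap.fourierMultiplierCLM ℂ (fun η => χ ((2 * Real.pi) • η)) v) x := by
  rw [op_eq_oscInt, op_eq_oscInt, SchwartzMap.fourierMultiplierCLM_apply,
    FourierTransform.fourier_fourierInv_eq]
  refine integral_congr_ae (ae_of_all _ fun η => ?_)
  dsimp only
  rw [SchwartzMap.smulLeftCLM_apply_apply (hasTemperateGrowth_comp_two_pi_smul hχ hc)]
  simp only [rescale, cutSymbol, smul_eq_mul]
  ring

theorem IsSpectralCutoff.op_cutSymbol_eq {v : 𝓢(Rn n, ℂ)} (h : IsSpectralCutoff χ (toDistr v))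
    (x : Rn n) : op (cutSymbol a χ) v x = op a v x := by
  rw [op_cutSymbol_eq_op_fourierMultiplierCLM h.1 h.2.1]
  congr 1
  apply toDistr_injective
  rw [← h.fourierMultiplierCLM_eq_self]
  exact (TemperedDistribution.fourierMultiplierCLM_toTemperedDistributionCLM_eq
    (hasTemperateGrowth_comp_two_pi_smul h.1 h.2.1) v).symm

theorem IsContinuousExtension.comp_fourierMultiplierCLM
    {T : 𝓢'(Rn n, ℂ) →L[ℂ] 𝓢'(Rn n, ℂ)} (hT : IsContinuousExtension a T)
    (hχ : ContDiff ℝ ∞ χ) (hc : HasCompactSupport χ) :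
    IsContinuousExtension (cutSymbol a χ) (T.comp
      (TemperedDistribution.fourierMultiplierCLM ℂ (fun η => χ ((2 * Real.pi) • η)))) := by
  intro v
  obtain ⟨w, hw, hw'⟩ := hT
    (SchwartzMap.fourierMultiplierCLM ℂ (fun η => χ ((2 * Real.pi) • η)) v)
  refine ⟨w, fun x => (hw x).trans (op_cutSymbol_eq_op_fourierMultiplierCLM hχ hc v x).symm, ?_⟩
  rw [← hw', ContinuousLinearMap.comp_apply]
  congr 1
  exact TemperedDistribution.fourierMultiplierCLM_toTemperedDistributionCLM_eq
    (hasTemperateGrowth_comp_two_pi_smul hχ hc) v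

/-- The value at `u` of the extension of the operator with symbol `a(x, ξ) χ(ξ)` is the same for
all spectral cut-offs `χ` of `u`. -/
theorem IsContinuousExtension.apply_eq_of_isSpectralCutoff
    (ha : SlowGrowth (fun p : Rn n × Rn n => a p.1 p.2)) {χ' : Rn n → ℂ} {u : 𝓢'(Rn n, ℂ)}
    {T T' : 𝓢'(Rn n, ℂ) →L[ℂ] 𝓢'(Rn n, ℂ)} (h : IsSpectralCutoff χ u)
    (h' : IsSpectralCutoff χ' u) (hT : IsContinuousExtension (cutSymbol a χ) T)
    (hT' : IsContinuousExtension (cutSymbol a χ') T') : T u = T' u := by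
  obtain ⟨S, P, hS, -, hSP, hP⟩ := exists_isContinuousExtension_cutSymbol ha h.1 h.2.1
  obtain ⟨S', P', hS', -, hSP', hP'⟩ := exists_isContinuousExtension_cutSymbol ha h'.1 h'.2.1
  rw [hT.unique hS, hT'.unique hS']
  ext φ
  rw [hSP, hSP']
  refine apply_eq_of_eqOn_nhdsSet_dsupport _ ?_
  -- Near the support both cut-offs are 1, and the remaining integral in P φ does not involve them.
  filter_upwards [h.eventually_nhdsSet_dsupport, h'.eventually_nhdsSet_dsupport] with η hη hη'
  rw [hP, hP', hη, hη']

end TypeOneOne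

end

theorem mainTheorem4 (n : ℕ) (a : TypeOneOne.Rn n → TypeOneOne.Rn n → ℂ)
    (ha : TypeOneOne.IsSymbolOneOne a) :
    ∃ A : TypeOneOne.compactSpectrum n →ₗ[ℂ] 𝓢'(TypeOneOne.Rn n, ℂ),
      -- `A` is `a(x, D)`, and it is the only such map
      TypeOneOne.IsOperatorOnCompactSpectrum a A ∧
      (∀ B : TypeOneOne.compactSpectrum n → 𝓢'(TypeOneOne.Rn n, ℂ),
        TypeOneOne.IsOperatorOnCompactSpectrum a B → B = A) ∧
      -- it coincides with `OP(a)` on the Schwartz functions with compact spectrum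
      (∀ (v : 𝓢(TypeOneOne.Rn n, ℂ))
        (hv : TypeOneOne.toDistr v ∈ TypeOneOne.compactSpectrum n),
        ∃ w : 𝓢(TypeOneOne.Rn n, ℂ), (∀ x, w x = TypeOneOne.op a v x) ∧
          A ⟨TypeOneOne.toDistr v, hv⟩ = TypeOneOne.toDistr w) ∧
      -- it coincides with the continuous extension of `OP(a)` to `𝓢'` if there is one
      (∀ T : 𝓢'(TypeOneOne.Rn n, ℂ) →L[ℂ] 𝓢'(TypeOneOne.Rn n, ℂ),
        TypeOneOne.IsContinuousExtension a T → ∀ u : TypeOneOne.compactSpectrum n, A u = T u) ∧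
      -- its range is contained in `O_M`
      ∀ u : TypeOneOne.compactSpectrum n, TypeOneOne.InOM (A u) := by
  obtain ⟨d, hd⟩ := ha
  have hs := hd.slowGrowth
  choose χ hχ using fun u : TypeOneOne.compactSpectrum n =>
    TypeOneOne.exists_isSpectralCutoff (K := TypeOneOne.spec (u : 𝓢'(TypeOneOne.Rn n, ℂ))) u.2
  have hχ' : ∀ u, TypeOneOne.IsSpectralCutoff (χ u) u.1 := fun u => hχ u u le_rfl
  choose T P hT hOM _ _ using fun u =>
    TypeOneOne.exists_isContinuousExtension_cutSymbol hs (hχ' u).1 (hχ' u).2.1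
  have key : ∀ (u : TypeOneOne.compactSpectrum n) (η : TypeOneOne.Rn n → ℂ)
      (S : 𝓢'(TypeOneOne.Rn n, ℂ) →L[ℂ] 𝓢'(TypeOneOne.Rn n, ℂ)),
      TypeOneOne.IsSpectralCutoff η u.1 →
      TypeOneOne.IsContinuousExtension (TypeOneOne.cutSymbol a η) S → T u u = S u :=
    fun u η S hη hS => (hT u).apply_eq_of_isSpectralCutoff hs (hχ' u) hη hS
  let A : TypeOneOne.compactSpectrum n →ₗ[ℂ] 𝓢'(TypeOneOne.Rn n, ℂ) :=
    { toFun := fun u => T u u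
      map_add' := fun u v => by
        -- One cut-off equal to 1 near both spectra computes all three values with the same linear
        -- operator S.
        obtain ⟨η, hη⟩ := TypeOneOne.exists_isSpectralCutoff (IsCompact.union u.2 v.2)
        have hu := hη u Set.subset_union_left
        obtain ⟨S, -, hS, -⟩ :=
          TypeOneOne.exists_isContinuousExtension_cutSymbol hs hu.1 hu.2.1
        rw [key u η S hu hS, key v η S (hη v Set.subset_union_right) hS,
          key (u + v) η S (hη _ (TypeOneOne.spec_add_subset _ _)) hS]
        exact map_add S _ _
      map_smul' := fun c u => by
        -- Scaling does not enlarge the spectrum, so the cut-off of u also serves c • u.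
        have hu := hχ u (c • u : 𝓢'(TypeOneOne.Rn n, ℂ)) (TypeOneOne.spec_smul_subset _ _)
        rw [key (c • u) _ _ hu (hT u)]
        exact map_smul (T u) c _ }
  have hA : TypeOneOne.IsOperatorOnCompactSpectrum a A := fun u η hη => by
    obtain ⟨S, -, hS, -⟩ := TypeOneOne.exists_isContinuousExtension_cutSymbol hs hη.1 hη.2.1
    exact ⟨S, hS, fun S' hS' => hS'.unique hS, key u η S hη hS⟩
  refine ⟨A, hA, fun B hB => funext fun u => ?_, fun v hv => ?_, fun S hS u => ?_,
    fun u => hOM u u⟩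
  · obtain ⟨S, hS, -, hBu⟩ := hB u (χ u) (hχ' u)
    rw [hBu, hS.unique (hT u)]
    rfl
  · obtain ⟨w, hw, hw'⟩ := hT ⟨_, hv⟩ v
    exact ⟨w, fun x => (hw x).trans ((hχ' ⟨_, hv⟩).op_cutSymbol_eq x), hw'⟩
  -- By uniqueness S ∘ χ(D) is the extension of the truncated operator, and χ(D) fixes u.
  · have h := (hS.comp_fourierMultiplierCLM (hχ' u).1 (hχ' u).2.1).unique (hT u)
    change T u u = S u
    rw [← h, ContinuousLinearMap.comp_apply, (hχ' u).fourierMultiplierCLM_eq_self]
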